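/- Fix $\lambda>0$. For $c_f,c_g>0$ and $k\neq 0$ let $f(y)=\frac{1}{2c_f}y^2$, $g(x)=\frac1{2c_g}x^2$, $h(x)=f(kx)+g(x)$, let $\mu^\ast=\mu^\ast_{c_f,c_g,k}$ be the probability measure on $\mathbb R$ with Lebesgue density proportional to $\exp(-h)$, and let $$A_{\mathrm{PD}}=\begin{pmatrix} c_g^{-1} & k\\ -\lambda k & \lambda c_f\end{pmatrix}.$$ For $B\in\mathbb R^{2\times 2}$ consider the primal-dual diffusion $\mathrm dZ_t=-A_{\mathrm{PD}}Z_t\,\mathrm dt+B\,\mathrm dW_t$ for $Z_t=(X_t,Y_t)\in\mathbb R^2$, where $W_t$ is Brownian motion in $\mathbb R^2$. A stationary solution of it is a probability measure $\pi$ on $\mathbb R^2$ such that the constant family $\pi_t=\pi$ solves the associated Fokker--Planck equation in the weak sense, i.e., with $\Sigma=\frac12BB^T$, $$\frac{\mathrm d}{\mathrm dt}\int\varphi\,\mathrm d\pi_t=\int\Big(\sum_{i,j}\Sigma_{ij}\,\partial_i\partial_j\varphi(z)-\nabla\varphi(z)\cdot A_{\mathrm{PD}}z\Big)\,\mathrm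 d\pi_t(z)\qquad\text{for all }\varphi\in C_c^\infty(\mathbb R^2),\ t\ge 0.$$ For every $B\in\mathbb R^{2\times2}$ and all $c_f,c_g>0$, $k\ne0$ there is exactly one stationary solution $\pi_\lambda$. However, there is no matrix $B\in\mathbb R^{2\times 2}$, chosen independently of $c_f$, $c_g$ and $k$ (it may depend on $\lambda$), such that for all $c_f,c_g>0$ and $k\neq0$ the stationary solution $\pi_\lambda$ has $x$-marginal $\mu^\ast_{c_f,c_g,k}$. -/

import Mathlib

open MeasureTheory Set
open scoped ContDiff Matrix

/-- The formal adjoint of the Fokker-Planck operator (the generator) of the diffusion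
`dZ = -A(Z) dt + B dW`, where `W` is a Brownian motion in `ℝ^κ` and `B` is a constant matrix:
`(L φ)(z) = ∑ i j, Σ i j * ∂ᵢ ∂ⱼ φ(z) - ∇φ(z) · A(z)` with `Σ = (1/2) B Bᵀ`. -/
noncomputable def diffusionGenerator {ι κ : Type*} [Fintype ι] [DecidableEq ι] [Fintype κ]
    (A : EuclideanSpace ℝ ι → EuclideanSpace ℝ ι) (B : Matrix ι κ ℝ)
    (φ : EuclideanSpace ℝ ι → ℝ) (z : EuclideanSpace ℝ ι) : ℝ :=
  (∑ i, ∑ j, ((1 / 2 : ℝ) • (B * Bᵀ)) i j *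
      fderiv ℝ (fun w => fderiv ℝ φ w (EuclideanSpace.single j 1)) z (EuclideanSpace.single i 1))
    - fderiv ℝ φ z (A z)

/-- The family `π t`, `t ≥ 0`, of probability measures is a (weak) solution of the Fokker-Planck
equation `∂ₜ π = ∇ · (A π + Σ ∇π)`, `Σ = (1/2) B Bᵀ`, of the diffusion `dZ = -A(Z) dt + B dW`:
`d/dt ∫ φ dπₜ = ∫ (∑ i j, Σ i j * ∂ᵢ ∂ⱼ φ - ∇φ · A) dπₜ` for all smooth compactly supported `φ`. -/
def IsFokkerPlanckSolution {ι κ : Type*} [Fintype ι] [DecidableEq ι] [Fintype κ]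
    (A : EuclideanSpace ℝ ι → EuclideanSpace ℝ ι) (B : Matrix ι κ ℝ)
    (π : ℝ → Measure (EuclideanSpace ℝ ι)) : Prop :=
  (∀ t : ℝ, 0 ≤ t → IsProbabilityMeasure (π t)) ∧
  ∀ φ : EuclideanSpace ℝ ι → ℝ, ContDiff ℝ ∞ φ → HasCompactSupport φ →
    ∀ t : ℝ, 0 ≤ t →
      HasDerivWithinAt (fun s => ∫ z, φ z ∂(π s)) (∫ z, diffusionGenerator A B φ z ∂(π t))
        (Ici 0) t

/-- `π` is a stationary solution of the diffusion `dZ = -A(Z) dt + B dW`: the constant family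
`πₜ = π` solves the Fokker-Planck equation. -/
def IsStationarySolution {ι κ : Type*} [Fintype ι] [DecidableEq ι] [Fintype κ]
    (A : EuclideanSpace ℝ ι → EuclideanSpace ℝ ι) (B : Matrix ι κ ℝ)
    (π : Measure (EuclideanSpace ℝ ι)) : Prop :=
  IsFokkerPlanckSolution A B (fun _ : ℝ => π)

/-- The dualized potential `f(y) = y² / (2 c_f)`. -/
noncomputable def gaussF (cf : ℝ) (y : ℝ) : ℝ := 1 / (2 * cf) * y ^ 2

/-- The primal potential `g(x) = x² / (2 c_g)`. -/
noncomputable def gaussG (cg : ℝ) (x : ℝ) : ℝ := 1 / (2 * cg) * x ^ 2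

/-- The potential `h(x) = f(k x) + g(x)`. -/
noncomputable def gaussH (cf cg k : ℝ) (x : ℝ) : ℝ := gaussF cf (k * x) + gaussG cg x

/-- The target `μ*` with Lebesgue density `exp(-h(x)) / ∫ exp(-h)`. -/
noncomputable def gaussTarget (cf cg k : ℝ) : Measure ℝ :=
  (volume : Measure ℝ).tilted (fun x => - gaussH cf cg k x)

/-- The matrix of the primal-dual drift in the one-dimensional Gaussian setting. -/
noncomputable def pdMatrix (lam cf cg k : ℝ) : Matrix (Fin 2) (Fin 2) ℝ :=
  !![cg⁻¹, k; -lam * k, lam * cf]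

/-- The linear map `z ↦ A_PD z` on `ℝ²`; the drift of the diffusion is `-A_PD z`. -/
noncomputable def pdDrift (lam cf cg k : ℝ) (z : EuclideanSpace ℝ (Fin 2)) :
    EuclideanSpace ℝ (Fin 2) :=
  WithLp.toLp 2 (pdMatrix lam cf cg k *ᵥ z.ofLp)

/-- The `x`-marginal of a measure on `ℝ² ∋ (x, y)`. -/
noncomputable def xMarginal (π : Measure (EuclideanSpace ℝ (Fin 2))) : Measure ℝ :=
  π.map (fun z => z 0)

/-!
A stationary solution of the linear diffusion `dZ = -A Z dt + B dW` is determined by Lyapunov's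
equation `A S + S Aᵀ = B Bᵀ`. If `A` has a quadratic Lyapunov function `z · P z`, testing the
stationary equation with rescaled cutoffs of it shows that every stationary solution has a finite
second moment, so that `z ↦ exp (i ξ · z)` is an admissible test function. Its equation says that
the characteristic function solves a scalar linear equation along the flow of `Aᵀ`; as this flow
tends to `0`, the only solution is the characteristic function of `N(0, S)`. Conversely `N(0, S)` is
stationary by Gaussian integration by parts.

For the primal-dual matrix `P = diag(lam, 1)` works, and eliminating `S` from Lyapunov's equation
turns `S 0 0 = Var μ*` into a linear relation between the entries of `B Bᵀ` and the parameters.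
Three choices of the parameters already make this relation incompatible with `0 ≤ (B Bᵀ) 1 1`.
-/

open Filter Topology ProbabilityTheory

section NormedSpace

variable {E : Type*} [NormedAddCommGroup E]

theorem hasFDerivAt_comp_inner [InnerProductSpace ℝ E] {θ : ℝ → ℝ} (hθ : Differentiable ℝ θ)
    (ξ z : E) :
    HasFDerivAt (fun z => θ (inner ℝ ξ z)) (deriv θ (inner ℝ ξ z) • innerSL ℝ ξ) z :=
  (hθ _).hasDerivAt.comp_hasFDerivAt z (innerSL ℝ ξ).hasFDerivAt

variable [NormedSpace ℝ E]

theorem contDiff_comp_smul {χ : E → ℝ} (hχ : ContDiff ℝ ∞ χ) (ε : ℝ) :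
    ContDiff ℝ ∞ fun z => χ (ε • z) :=
  hχ.comp (contDiff_const_smul ε)

theorem hasCompactSupport_fderiv_apply {φ : E → ℝ} (A : E → E) (hφ : HasCompactSupport φ) :
    HasCompactSupport fun z => fderiv ℝ φ z (A z) := by
  refine (hφ.fderiv (𝕜 := ℝ)).mono fun z => ?_
  simp only [Function.mem_support]
  contrapose!
  intro hz
  simp [hz]

end NormedSpace

section PartialDeriv

variable {ι : Type*} [DecidableEq ι]

/-- The partial derivative `∂ᵢ φ`, in the form in which `diffusionGenerator` uses it. -/
noncomputable def partialDeriv (i : ι) (φ : EuclideanSpace ℝ ι → ℝ) (z : EuclideanSpace ℝ ι) : ℝ :=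
  fderiv ℝ φ z (EuclideanSpace.single i 1)

theorem hasCompactSupport_partialDeriv {φ : EuclideanSpace ℝ ι → ℝ} (hφ : HasCompactSupport φ)
    (i : ι) : HasCompactSupport (partialDeriv i φ) :=
  hφ.fderiv_apply (𝕜 := ℝ) _

section

variable [Finite ι]

theorem partialDeriv_add {f g : EuclideanSpace ℝ ι → ℝ} (hf : Differentiable ℝ f)
    (hg : Differentiable ℝ g) (i : ι) :
    partialDeriv i (fun z => f z + g z) = fun z => partialDeriv i f z + partialDeriv i g z := by
  have := Fintype.ofFinite ι
  ext z
  simp [partialDeriv, fderiv_fun_add (hf z) (hg z)]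

theorem partialDeriv_mul {f g : EuclideanSpace ℝ ι → ℝ} (hf : Differentiable ℝ f)
    (hg : Differentiable ℝ g) (i : ι) :
    partialDeriv i (fun z => f z * g z) =
      fun z => f z * partialDeriv i g z + g z * partialDeriv i f z := by
  have := Fintype.ofFinite ι
  ext z
  simp [partialDeriv, fderiv_fun_mul (hf z) (hg z)]

theorem partialDeriv_const_mul (c : ℝ) (i : ι) (φ : EuclideanSpace ℝ ι → ℝ) :
    partialDeriv i (fun z => c * φ z) = fun z => c * partialDeriv i φ z := by
  have := Fintype.ofFinite ι
  ext z
  simp only [partialDeriv, show (fun z => c * φ z) = c • φ from rfl, fderiv_const_smul_field]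
  simp

theorem partialDeriv_comp_smul (ε : ℝ) (i : ι) (φ : EuclideanSpace ℝ ι → ℝ) :
    partialDeriv i (fun z => φ (ε • z)) = fun z => ε * partialDeriv i φ (ε • z) := by
  have := Fintype.ofFinite ι
  ext z
  simp [partialDeriv, fderiv_comp_smul]

end

variable [Fintype ι]

theorem fderiv_apply_eq_sum_partialDeriv (φ : EuclideanSpace ℝ ι → ℝ) (z v : EuclideanSpace ℝ ι) :
    fderiv ℝ φ z v = ∑ i, v i * partialDeriv i φ z := by
  have hv : v = ∑ i, v i • EuclideanSpace.single i (1 : ℝ) := by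
    ext j
    simp [Finset.sum_apply, Pi.single_apply]
  conv_lhs => rw [hv]
  simp [partialDeriv]

theorem contDiff_partialDeriv {φ : EuclideanSpace ℝ ι → ℝ} (hφ : ContDiff ℝ ∞ φ) (i : ι) :
    ContDiff ℝ ∞ (partialDeriv i φ) :=
  (hφ.fderiv_right (m := ∞) (by simp)).clm_apply contDiff_const

theorem partialDeriv_comp_inner {θ : ℝ → ℝ} (hθ : Differentiable ℝ θ) (ξ : EuclideanSpace ℝ ι)
    (i : ι) :
    partialDeriv i (fun z => θ (inner ℝ ξ z)) = fun z => ξ i * deriv θ (inner ℝ ξ z) := by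
  ext z
  simp [partialDeriv, (hasFDerivAt_comp_inner hθ ξ z).fderiv, EuclideanSpace.inner_single_right,
    mul_comm]

end PartialDeriv

section Generator

variable {ι κ : Type*} [Fintype ι] [DecidableEq ι] [Fintype κ]

/-- The second-order part `∑ i j, Σ i j * ∂ᵢ ∂ⱼ φ`, `Σ = (1/2) B Bᵀ`, of `diffusionGenerator`. -/
noncomputable def diffusionTerm (B : Matrix ι κ ℝ) (φ : EuclideanSpace ℝ ι → ℝ)
    (z : EuclideanSpace ℝ ι) : ℝ :=
  ∑ i, ∑ j, ((1 / 2 : ℝ) • (B * Bᵀ)) i j * partialDeriv i (partialDeriv j φ) z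

/-- The carré du champ `∑ i j, Σ i j * ∂ᵢ f * ∂ⱼ g`, `Σ = (1/2) B Bᵀ`: it measures the failure of
`diffusionTerm B` to be a derivation. -/
noncomputable def carreDuChamp (B : Matrix ι κ ℝ) (f g : EuclideanSpace ℝ ι → ℝ)
    (z : EuclideanSpace ℝ ι) : ℝ :=
  ∑ i, ∑ j, ((1 / 2 : ℝ) • (B * Bᵀ)) i j * (partialDeriv i f z * partialDeriv j g z)

variable {A : EuclideanSpace ℝ ι → EuclideanSpace ℝ ι} {B : Matrix ι κ ℝ}
  {f g φ : EuclideanSpace ℝ ι → ℝ}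

theorem diffusionGenerator_eq (A : EuclideanSpace ℝ ι → EuclideanSpace ℝ ι) (B : Matrix ι κ ℝ)
    (φ : EuclideanSpace ℝ ι → ℝ) (z : EuclideanSpace ℝ ι) :
    diffusionGenerator A B φ z = diffusionTerm B φ z - fderiv ℝ φ z (A z) :=
  rfl

theorem continuous_diffusionTerm (B : Matrix ι κ ℝ) (hφ : ContDiff ℝ ∞ φ) :
    Continuous (diffusionTerm B φ) := by
  have h i j : Continuous (partialDeriv i (partialDeriv j φ)) :=
    (contDiff_partialDeriv (contDiff_partialDeriv hφ j) i).continuous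
  unfold diffusionTerm
  fun_prop

theorem hasCompactSupport_diffusionTerm (B : Matrix ι κ ℝ) (hφ : HasCompactSupport φ) :
    HasCompactSupport (diffusionTerm B φ) := by
  refine hφ.mono' fun z => ?_
  contrapose!
  intro hz
  have h i j : partialDeriv i (partialDeriv j φ) z = 0 :=
    image_eq_zero_of_notMem_tsupport fun h => hz <| (tsupport_fderiv_apply_subset ℝ _).trans
      (tsupport_fderiv_apply_subset ℝ _) h
  simp [diffusionTerm, h]

theorem carreDuChamp_comm (B : Matrix ι κ ℝ) (f g : EuclideanSpace ℝ ι → ℝ) :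
    carreDuChamp B f g = carreDuChamp B g f := by
  ext z
  unfold carreDuChamp
  rw [Finset.sum_comm]
  refine Finset.sum_congr rfl fun i _ => Finset.sum_congr rfl fun j _ => ?_
  rw [mul_comm (partialDeriv j f z), ← Matrix.transpose_apply ((1 / 2 : ℝ) • (B * Bᵀ)) i j,
    Matrix.transpose_smul, Matrix.transpose_mul, Matrix.transpose_transpose]

theorem diffusionTerm_mul (B : Matrix ι κ ℝ) (hf : ContDiff ℝ ∞ f) (hg : ContDiff ℝ ∞ g)
    (z : EuclideanSpace ℝ ι) :
    diffusionTerm B (fun z => f z * g z) z =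
      f z * diffusionTerm B g z + g z * diffusionTerm B f z + 2 * carreDuChamp B f g z := by
  have hd {u : EuclideanSpace ℝ ι → ℝ} (hu : ContDiff ℝ ∞ u) : Differentiable ℝ u :=
    hu.differentiable (by simp)
  have hd' {u : EuclideanSpace ℝ ι → ℝ} (hu : ContDiff ℝ ∞ u) (j : ι) :
      Differentiable ℝ (partialDeriv j u) := hd (contDiff_partialDeriv hu j)
  have hleibniz i j : partialDeriv i (partialDeriv j fun z => f z * g z) z =
      f z * partialDeriv i (partialDeriv j g) z + g z * partialDeriv i (partialDeriv j f) z +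
        (partialDeriv i f z * partialDeriv j g z + partialDeriv i g z * partialDeriv j f z) := by
    rw [partialDeriv_mul (hd hf) (hd hg),
      partialDeriv_add ((hd hf).fun_mul (hd' hg j)) ((hd hg).fun_mul (hd' hf j)),
      partialDeriv_mul (hd hf) (hd' hg j), partialDeriv_mul (hd hg) (hd' hf j)]
    ring
  rw [two_mul]
  nth_rw 2 [carreDuChamp_comm]
  simp only [diffusionTerm, carreDuChamp, hleibniz, mul_add, Finset.sum_add_distrib,
    Finset.mul_sum, mul_left_comm (f z), mul_left_comm (g z)]

theorem diffusionGenerator_mul (hf : ContDiff ℝ ∞ f) (hg : ContDiff ℝ ∞ g)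
    (z : EuclideanSpace ℝ ι) :
    diffusionGenerator A B (fun z => f z * g z) z =
      f z * diffusionGenerator A B g z + g z * diffusionGenerator A B f z +
        2 * carreDuChamp B f g z := by
  simp only [diffusionGenerator_eq, diffusionTerm_mul B hf hg,
    fderiv_fun_mul (hf.differentiable (by simp) z) (hg.differentiable (by simp) z)]
  simp only [add_apply, smul_apply, smul_eq_mul]
  ring

theorem diffusionTerm_comp_smul (B : Matrix ι κ ℝ) (φ : EuclideanSpace ℝ ι → ℝ) (ε : ℝ)
    (z : EuclideanSpace ℝ ι) :
    diffusionTerm B (fun z => φ (ε • z)) z = ε ^ 2 * diffusionTerm B φ (ε • z) := by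
  simp only [diffusionTerm, partialDeriv_comp_smul, partialDeriv_const_mul, Finset.mul_sum]
  refine Finset.sum_congr rfl fun i _ => Finset.sum_congr rfl fun j _ => ?_
  ring

theorem diffusionGenerator_comp_smul (A : EuclideanSpace ℝ ι →L[ℝ] EuclideanSpace ℝ ι)
    (B : Matrix ι κ ℝ) (φ : EuclideanSpace ℝ ι → ℝ) (ε : ℝ) (z : EuclideanSpace ℝ ι) :
    diffusionGenerator A B (fun z => φ (ε • z)) z =
      ε ^ 2 * diffusionTerm B φ (ε • z) - fderiv ℝ φ (ε • z) (A (ε • z)) := by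
  rw [diffusionGenerator_eq, diffusionTerm_comp_smul]
  simp [fderiv_comp_smul]

theorem abs_carreDuChamp_le {F G : ℝ} (z : EuclideanSpace ℝ ι)
    (hf : ∀ i, |partialDeriv i f z| ≤ F) (hg : ∀ i, |partialDeriv i g z| ≤ G) :
    |carreDuChamp B f g z| ≤ (∑ i, ∑ j, |((1 / 2 : ℝ) • (B * Bᵀ)) i j|) * (F * G) := by
  simp only [Finset.sum_mul]
  refine (Finset.abs_sum_le_sum_abs _ _).trans (Finset.sum_le_sum fun i _ =>
    (Finset.abs_sum_le_sum_abs _ _).trans (Finset.sum_le_sum fun j _ => ?_))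
  rw [abs_mul, abs_mul]
  gcongr
  exacts [(abs_nonneg _).trans (hf i), hf i, hg j]

theorem diffusionTerm_comp_inner (B : Matrix ι κ ℝ) {θ : ℝ → ℝ} (hθ : ContDiff ℝ ∞ θ)
    (ξ z : EuclideanSpace ℝ ι) :
    diffusionTerm B (fun z => θ (inner ℝ ξ z)) z =
      deriv (deriv θ) (inner ℝ ξ z) * (ξ ⬝ᵥ (B * Bᵀ) *ᵥ ξ / 2) := by
  have hθ' : Differentiable ℝ (deriv θ) :=
    ((contDiff_infty_iff_deriv.1 hθ).2).differentiable (by simp)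
  simp only [diffusionTerm, partialDeriv_comp_inner (hθ.differentiable (by simp)),
    partialDeriv_const_mul, partialDeriv_comp_inner hθ', dotProduct, Matrix.mulVec,
    Matrix.smul_apply, smul_eq_mul, Finset.sum_div, Finset.mul_sum]
  refine Finset.sum_congr rfl fun i _ => Finset.sum_congr rfl fun j _ => ?_
  ring

end Generator

section Stationary

variable {ι κ : Type*} [Fintype ι] [DecidableEq ι] [Fintype κ]

theorem isStationarySolution_iff {A : EuclideanSpace ℝ ι → EuclideanSpace ℝ ι} {B : Matrix ι κ ℝ}
    {π : Measure (EuclideanSpace ℝ ι)} :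
    IsStationarySolution A B π ↔ IsProbabilityMeasure π ∧
      ∀ φ : EuclideanSpace ℝ ι → ℝ, ContDiff ℝ ∞ φ → HasCompactSupport φ →
        ∫ z, diffusionGenerator A B φ z ∂π = 0 := by
  constructor
  · rintro ⟨hprob, hderiv⟩
    exact ⟨hprob 0 le_rfl, fun φ hφ hc => (uniqueDiffOn_Ici (0 : ℝ) 0 self_mem_Ici).eq_deriv _
      (hderiv φ hφ hc 0 le_rfl) (hasDerivWithinAt_const _ _ _)⟩
  · rintro ⟨hprob, hzero⟩
    refine ⟨fun _ _ => hprob, fun φ hφ hc t _ => ?_⟩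
    rw [hzero φ hφ hc]
    exact hasDerivWithinAt_const _ _ _

theorem IsStationarySolution.isProbabilityMeasure
    {A : EuclideanSpace ℝ ι → EuclideanSpace ℝ ι} {B : Matrix ι κ ℝ}
    {π : Measure (EuclideanSpace ℝ ι)} (hπ : IsStationarySolution A B π) :
    IsProbabilityMeasure π :=
  (isStationarySolution_iff.1 hπ).1

variable {A : EuclideanSpace ℝ ι →L[ℝ] EuclideanSpace ℝ ι} {B : Matrix ι κ ℝ}
  {g χ : EuclideanSpace ℝ ι → ℝ}

theorem continuous_diffusionGenerator (A : EuclideanSpace ℝ ι →L[ℝ] EuclideanSpace ℝ ι)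
    (B : Matrix ι κ ℝ) (hg : ContDiff ℝ ∞ g) : Continuous (diffusionGenerator A B g) :=
  (continuous_diffusionTerm B hg).sub
    ((hg.continuous_fderiv (by simp)).clm_apply A.continuous)

theorem carreDuChamp_comp_smul (B : Matrix ι κ ℝ) (g χ : EuclideanSpace ℝ ι → ℝ) (ε : ℝ)
    (z : EuclideanSpace ℝ ι) :
    carreDuChamp B g (fun z => χ (ε • z)) z =
      ε * ∑ i, ∑ j, ((1 / 2 : ℝ) • (B * Bᵀ)) i j *
        (partialDeriv i g z * partialDeriv j χ (ε • z)) := by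
  simp only [carreDuChamp, partialDeriv_comp_smul, Finset.mul_sum]
  refine Finset.sum_congr rfl fun i _ => Finset.sum_congr rfl fun j _ => ?_
  ring

theorem tendsto_diffusionGenerator_mul_comp_smul (hg : ContDiff ℝ ∞ g) (hχ : ContDiff ℝ ∞ χ)
    (hχ0 : χ 0 = 1) (z : EuclideanSpace ℝ ι) :
    Tendsto (fun ε : ℝ => diffusionGenerator A B (fun z => g z * χ (ε • z)) z) (𝓝 0)
      (𝓝 (diffusionGenerator A B g z)) := by
  have hscale : Continuous fun ε : ℝ => ε • z := by fun_prop
  have hχc := hχ.continuous.comp hscale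
  have hterm := (continuous_diffusionTerm B hχ).comp hscale
  have hdrift := ((hχ.continuous_fderiv (by simp)).clm_apply A.continuous).comp hscale
  have hpartial i := (contDiff_partialDeriv hχ i).continuous.comp hscale
  simp only [Function.comp_def] at hχc hterm hdrift hpartial
  simp only [fun ε => diffusionGenerator_mul (A := A) (B := B) hg (contDiff_comp_smul hχ ε),
    diffusionGenerator_comp_smul, carreDuChamp_comp_smul]
  refine Continuous.tendsto' (by fun_prop) _ _ ?_
  simp [hχ0]

theorem exists_bound_partialDeriv_comp_smul (hχ : ContDiff ℝ ∞ χ) (hχs : HasCompactSupport χ) :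
    ∃ N : ℝ, ∀ ε ∈ Ioc (0 : ℝ) 1, ∀ i z, |partialDeriv i (fun z => χ (ε • z)) z| ≤ N := by
  obtain ⟨N, hN⟩ := (hχs.fderiv (𝕜 := ℝ)).exists_bound_of_continuous
    (hχ.continuous_fderiv (by simp))
  refine ⟨N, fun ε hε i z => ?_⟩
  rw [partialDeriv_comp_smul, abs_mul, abs_of_pos hε.1]
  refine (mul_le_of_le_one_left (abs_nonneg _) hε.2).trans ?_
  exact ((fderiv ℝ χ (ε • z)).le_opNorm _).trans (by simpa using hN _)

theorem exists_bound_diffusionGenerator_comp_smul (hχ : ContDiff ℝ ∞ χ)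
    (hχs : HasCompactSupport χ) :
    ∃ M : ℝ, ∀ ε ∈ Ioc (0 : ℝ) 1, ∀ z, |diffusionGenerator A B (fun z => χ (ε • z)) z| ≤ M := by
  obtain ⟨M, hM⟩ := (hasCompactSupport_diffusionTerm B hχs).exists_bound_of_continuous
    (continuous_diffusionTerm B hχ)
  obtain ⟨K, hK⟩ := (hasCompactSupport_fderiv_apply A hχs).exists_bound_of_continuous
    ((hχ.continuous_fderiv (by simp)).clm_apply A.continuous)
  refine ⟨M + K, fun ε hε z => ?_⟩
  rw [diffusionGenerator_comp_smul]
  have hterm : |ε ^ 2 * diffusionTerm B χ (ε • z)| ≤ M := by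
    rw [abs_mul, abs_of_nonneg (sq_nonneg ε)]
    exact (mul_le_of_le_one_left (abs_nonneg _) (pow_le_one₀ hε.1.le hε.2)).trans (hM _)
  exact (abs_sub _ _).trans (add_le_add hterm (hK _))

theorem exists_bound_diffusionGenerator_mul_comp_smul (hg : ContDiff ℝ ∞ g)
    (hχ : ContDiff ℝ ∞ χ) (hχs : HasCompactSupport χ) {G : ℝ} (hG : ∀ z, |g z| ≤ G)
    (hG' : ∀ i z, |partialDeriv i g z| ≤ G) :
    ∃ C D : ℝ, ∀ ε ∈ Ioc (0 : ℝ) 1, ∀ z,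
      |diffusionGenerator A B (fun z => g z * χ (ε • z)) z| ≤
        C + D * |diffusionGenerator A B g z| := by
  have hG0 : 0 ≤ G := (abs_nonneg _).trans (hG 0)
  obtain ⟨D, hD⟩ := hχs.exists_bound_of_continuous hχ.continuous
  obtain ⟨N, hN⟩ := exists_bound_partialDeriv_comp_smul hχ hχs
  obtain ⟨M, hM⟩ := exists_bound_diffusionGenerator_comp_smul (A := A) (B := B) hχ hχs
  simp only [Real.norm_eq_abs] at hD
  set σ := ∑ i, ∑ j, |((1 / 2 : ℝ) • (B * Bᵀ)) i j|
  refine ⟨G * M + 2 * (σ * (G * N)), D, fun ε hε z => ?_⟩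
  rw [diffusionGenerator_mul hg (contDiff_comp_smul hχ ε)]
  calc |g z * diffusionGenerator A B (fun z => χ (ε • z)) z +
        χ (ε • z) * diffusionGenerator A B g z + 2 * carreDuChamp B g (fun z => χ (ε • z)) z|
      ≤ |g z| * |diffusionGenerator A B (fun z => χ (ε • z)) z| +
        |χ (ε • z)| * |diffusionGenerator A B g z| +
        2 * |carreDuChamp B g (fun z => χ (ε • z)) z| := by
        simpa only [abs_mul, abs_two] using abs_add_three
          (g z * diffusionGenerator A B (fun z => χ (ε • z)) z)
          (χ (ε • z) * diffusionGenerator A B g z) (2 * carreDuChamp B g (fun z => χ (ε • z)) z)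
    _ ≤ G * M + D * |diffusionGenerator A B g z| + 2 * (σ * (G * N)) := by
        gcongr
        exacts [hG z, hM ε hε z, hD _,
          abs_carreDuChamp_le z (fun i => hG' i z) fun i => hN ε hε i z]
    _ = _ := by ring

/-- The hypothesis on the derivatives of `g` is first order only: by scaling, the derivatives of
the cutoff `χ (ε • z)` are bounded on `ℝ^ι` even after multiplication by the linear drift. -/
theorem IsStationarySolution.integral_diffusionGenerator_eq_zero {π : Measure (EuclideanSpace ℝ ι)}
    (hπ : IsStationarySolution A B π) (hg : ContDiff ℝ ∞ g) {G : ℝ} (hG : ∀ z, |g z| ≤ G)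
    (hG' : ∀ i z, |partialDeriv i g z| ≤ G) (hint : Integrable (diffusionGenerator A B g) π) :
    ∫ z, diffusionGenerator A B g z ∂π = 0 := by
  obtain ⟨hprob, hzero⟩ := isStationarySolution_iff.1 hπ
  let χ : ContDiffBump (0 : EuclideanSpace ℝ ι) := ⟨1, 2, one_pos, one_lt_two⟩
  have hχ0 : χ 0 = 1 := χ.one_of_mem_closedBall (Metric.mem_closedBall_self χ.rIn_pos.le)
  obtain ⟨C, D, hbound⟩ := exists_bound_diffusionGenerator_mul_comp_smul (A := A) (B := B) hg
    χ.contDiff χ.hasCompactSupport hG hG'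
  have hlim : Tendsto (fun ε : ℝ => ∫ z, diffusionGenerator A B (fun z => g z * χ (ε • z)) z ∂π)
      (𝓝[>] 0) (𝓝 (∫ z, diffusionGenerator A B g z ∂π)) := by
    refine tendsto_integral_filter_of_dominated_convergence
      (fun z => C + D * |diffusionGenerator A B g z|)
      (Eventually.of_forall fun ε => (continuous_diffusionGenerator A B
        (hg.mul (contDiff_comp_smul χ.contDiff ε))).aestronglyMeasurable) ?_
      ((integrable_const C).add (hint.abs.const_mul D)) (ae_of_all _ fun z =>
        (tendsto_diffusionGenerator_mul_comp_smul hg χ.contDiff hχ0 z).mono_left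
          nhdsWithin_le_nhds)
    filter_upwards [Ioc_mem_nhdsGT one_pos] with ε hε
    exact ae_of_all _ (hbound ε hε)
  refine tendsto_nhds_unique hlim (tendsto_const_nhds.congr' ?_)
  filter_upwards [self_mem_nhdsWithin] with ε (hε : 0 < ε)
  exact (hzero _ (hg.mul (contDiff_comp_smul χ.contDiff ε))
    (χ.hasCompactSupport.comp_smul hε.ne').mul_left).symm

end Stationary

section Stability

variable {ι : Type*} [Fintype ι]

theorem hasFDerivAt_dotProduct_mulVec (X : Matrix ι ι ℝ) (z : EuclideanSpace ℝ ι) :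
    HasFDerivAt (fun z : EuclideanSpace ℝ ι => z ⬝ᵥ X *ᵥ z)
      (innerSL ℝ (WithLp.toLp 2 ((X + Xᵀ) *ᵥ z))) z := by
  classical
  let L := Matrix.toEuclideanCLM (𝕜 := ℝ) X
  have hinner : (fun z : EuclideanSpace ℝ ι => z ⬝ᵥ X *ᵥ z) = fun z => inner ℝ z (L z) := by
    ext z
    simp [L, Matrix.inner_toEuclideanCLM]
  rw [hinner]
  refine ((hasFDerivAt_id z).inner ℝ L.hasFDerivAt).congr_fderiv ?_
  ext v
  have htranspose : v ⬝ᵥ Xᵀ *ᵥ z = z ⬝ᵥ X *ᵥ v := by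
    rw [Matrix.mulVec_transpose, dotProduct_comm, Matrix.dotProduct_mulVec]
  simp [L, EuclideanSpace.inner_eq_star_dotProduct, Matrix.add_mulVec, htranspose,
    dotProduct_comm (X *ᵥ v.ofLp), dotProduct_comm (X *ᵥ z.ofLp), add_comm]

theorem inner_add_transpose_mulVec (X A : Matrix ι ι ℝ) (z : EuclideanSpace ℝ ι) :
    inner ℝ (WithLp.toLp 2 ((X + Xᵀ) *ᵥ z)) (WithLp.toLp 2 (A *ᵥ z)) =
      z ⬝ᵥ (X * A + Aᵀ * X) *ᵥ z := by
  have hX : z ⬝ᵥ (X * A) *ᵥ z = A *ᵥ z ⬝ᵥ Xᵀ *ᵥ z := by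
    rw [← Matrix.mulVec_mulVec, Matrix.dotProduct_mulVec, ← Matrix.mulVec_transpose,
      dotProduct_comm]
  have hA : z ⬝ᵥ (Aᵀ * X) *ᵥ z = A *ᵥ z ⬝ᵥ X *ᵥ z := by
    rw [← Matrix.mulVec_mulVec, Matrix.dotProduct_mulVec, Matrix.vecMul_transpose]
  simp [EuclideanSpace.inner_eq_star_dotProduct, Matrix.add_mulVec, hX, hA, add_comm]

theorem exists_pos_mul_norm_sq_le_of_posDef {P : Matrix ι ι ℝ} (hP : P.PosDef) :
    ∃ c > 0, ∀ z : EuclideanSpace ℝ ι, c * ‖z‖ ^ 2 ≤ z ⬝ᵥ P *ᵥ z := by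
  have hcont : Continuous fun z : EuclideanSpace ℝ ι => (z : ι → ℝ) ⬝ᵥ P *ᵥ z := by fun_prop
  obtain ⟨c, hc, hmin⟩ := (isCompact_sphere (0 : EuclideanSpace ℝ ι) 1).exists_forall_le'
    hcont.continuousOn (a := 0) fun z hz => by
      have hz0 : z ≠ 0 := ne_zero_of_mem_unit_sphere ⟨z, hz⟩
      simpa using hP.dotProduct_mulVec_pos (x := z) (by simpa using hz0)
  refine ⟨c, hc, fun z => ?_⟩
  rcases eq_or_ne z 0 with rfl | hz
  · simp
  have hunit := hmin (‖z‖⁻¹ • z) (by simp [norm_smul, hz])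
  have hnorm : 0 < ‖z‖ := norm_pos_iff.2 hz
  rw [WithLp.ofLp_smul, Matrix.mulVec_smul, dotProduct_smul, smul_dotProduct, smul_eq_mul,
    smul_eq_mul] at hunit
  calc c * ‖z‖ ^ 2 ≤ ‖z‖⁻¹ * (‖z‖⁻¹ * (z ⬝ᵥ P *ᵥ z)) * ‖z‖ ^ 2 := by gcongr
    _ = z ⬝ᵥ P *ᵥ z := by field_simp

theorem exists_dotProduct_mulVec_le_mul_norm_sq (P : Matrix ι ι ℝ) :
    ∃ C > 0, ∀ z : EuclideanSpace ℝ ι, z ⬝ᵥ P *ᵥ z ≤ C * ‖z‖ ^ 2 := by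
  classical
  refine ⟨‖Matrix.toEuclideanCLM (𝕜 := ℝ) P‖ + 1, by positivity, fun z => ?_⟩
  have hinner : z ⬝ᵥ P *ᵥ z = inner ℝ z (Matrix.toEuclideanCLM (𝕜 := ℝ) P z) := by
    simp [Matrix.inner_toEuclideanCLM]
  rw [hinner]
  calc inner ℝ z (Matrix.toEuclideanCLM (𝕜 := ℝ) P z)
      ≤ ‖z‖ * (‖Matrix.toEuclideanCLM (𝕜 := ℝ) P‖ * ‖z‖) :=
        (real_inner_le_norm _ _).trans (by gcongr; exact ContinuousLinearMap.le_opNorm _ _)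
    _ ≤ (‖Matrix.toEuclideanCLM (𝕜 := ℝ) P‖ + 1) * ‖z‖ ^ 2 := by nlinarith [sq_nonneg ‖z‖]

/-- `A` is positively stable: the flow of `x' = -A x` has a strict quadratic Lyapunov function
`x ↦ x · P x`. By Lyapunov's theorem this says that the spectrum of `A` lies in the open right
half-plane; the certificate `P` is what the proofs use. -/
def IsPositiveStable (A : Matrix ι ι ℝ) : Prop :=
  ∃ P : Matrix ι ι ℝ, P.PosDef ∧ (P * A + Aᵀ * P).PosDef

theorem IsPositiveStable.transpose {A : Matrix ι ι ℝ} (hA : IsPositiveStable A) :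
    IsPositiveStable Aᵀ := by
  classical
  obtain ⟨P, hP, hPA⟩ := hA
  have hPu : IsUnit P.det := (Matrix.isUnit_iff_isUnit_det P).1 hP.isUnit
  have hcongr : P⁻¹ * Aᵀ + A * P⁻¹ = P⁻¹ * (P * A + Aᵀ * P) * (P⁻¹)ᴴ := by
    rw [hP.inv.isHermitian.eq]
    simp only [mul_add, add_mul, Matrix.mul_assoc, Matrix.mul_nonsing_inv P hPu, Matrix.mul_one]
    rw [← Matrix.mul_assoc, Matrix.nonsing_inv_mul P hPu, Matrix.one_mul, add_comm]
  refine ⟨P⁻¹, hP.inv, ?_⟩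
  rw [Matrix.transpose_transpose, hcongr]
  exact hPA.mul_mul_conjTranspose_same (Matrix.vecMul_injective_of_isUnit hP.inv.isUnit)

/-- `x` solves `x' = -A x` on `ℝ`. -/
def IsTrajectory (A : Matrix ι ι ℝ) (x : ℝ → EuclideanSpace ℝ ι) : Prop :=
  ∀ t, HasDerivAt x (WithLp.toLp 2 (-(A *ᵥ x t))) t

theorem exists_isTrajectory (A : Matrix ι ι ℝ) (ξ : EuclideanSpace ℝ ι) :
    ∃ x, IsTrajectory A x ∧ x 0 = ξ := by
  classical
  let L := Matrix.toEuclideanCLM (𝕜 := ℝ) A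
  refine ⟨fun t => NormedSpace.exp (t • -L) ξ, fun t => ?_, by simp⟩
  refine ((hasDerivAt_exp_smul_const' (𝕂 := ℝ) (-L) t).clm_apply (hasDerivAt_const t ξ)).congr_deriv
    ?_
  ext i
  simp [L]

theorem IsTrajectory.hasDerivAt_dotProduct_mulVec {A : Matrix ι ι ℝ}
    {x y : ℝ → EuclideanSpace ℝ ι} (hx : IsTrajectory A x) (hy : IsTrajectory A y)
    (X : Matrix ι ι ℝ) (t : ℝ) :
    HasDerivAt (fun t => x t ⬝ᵥ X *ᵥ y t) (-(x t ⬝ᵥ (X * A + Aᵀ * X) *ᵥ y t)) t := by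
  classical
  let L := Matrix.toEuclideanCLM (𝕜 := ℝ) X
  have hinner : (fun t => x t ⬝ᵥ X *ᵥ y t) = fun t => inner ℝ (x t) (L (y t)) := by
    ext t
    simp [L, Matrix.inner_toEuclideanCLM]
  rw [hinner]
  refine ((hx t).inner ℝ (L.hasFDerivAt.comp_hasDerivAt t (hy t))).congr_deriv ?_
  have hA : x t ⬝ᵥ Aᵀ *ᵥ X *ᵥ (y t).ofLp = A *ᵥ (x t).ofLp ⬝ᵥ X *ᵥ (y t).ofLp := by
    rw [Matrix.dotProduct_mulVec _ Aᵀ, Matrix.vecMul_transpose]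
  simp only [L, EuclideanSpace.inner_eq_star_dotProduct, Matrix.ofLp_toEuclideanCLM, star_trivial,
    Matrix.mulVec_neg, dotProduct_neg, Matrix.add_mulVec, dotProduct_add,
    ← Matrix.mulVec_mulVec, hA, neg_add, Function.comp_apply, dotProduct_comm _ (x t).ofLp,
    dotProduct_comm _ (A *ᵥ (x t).ofLp)]

theorem IsPositiveStable.tendsto_zero {A : Matrix ι ι ℝ} (hA : IsPositiveStable A)
    {x : ℝ → EuclideanSpace ℝ ι} (hx : IsTrajectory A x) : Tendsto x atTop (𝓝 0) := by
  obtain ⟨P, hP, hPA⟩ := hA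
  obtain ⟨c, hc, hcP⟩ := exists_pos_mul_norm_sq_le_of_posDef hP
  obtain ⟨q, hq, hqPA⟩ := exists_pos_mul_norm_sq_le_of_posDef hPA
  obtain ⟨C, hC, hCP⟩ := exists_dotProduct_mulVec_le_mul_norm_sq P
  let V t := x t ⬝ᵥ P *ᵥ x t
  have hdecay : Antitone fun t => V t * Real.exp (q / C * t) := by
    refine antitone_of_hasDerivAt_nonpos (fun t => (hx.hasDerivAt_dotProduct_mulVec hx P t).mul
      (((hasDerivAt_id t).const_mul (q / C)).exp)) fun t => ?_
    have hrate : q / C * V t ≤ x t ⬝ᵥ (P * A + Aᵀ * P) *ᵥ x t :=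
      calc q / C * V t ≤ q / C * (C * ‖x t‖ ^ 2) := by gcongr; exact hCP _
        _ = q * ‖x t‖ ^ 2 := by field_simp
        _ ≤ _ := hqPA _
    have := mul_nonneg (sub_nonneg.2 hrate) (Real.exp_pos (q / C * t)).le
    simp only [id, mul_one, Pi.zero_apply]
    linarith
  have hbound t (ht : 0 ≤ t) : ‖x t‖ ^ 2 ≤ V 0 / c * Real.exp (-(q / C * t)) := by
    have hV : V t * Real.exp (q / C * t) ≤ V 0 := by simpa using hdecay ht
    rw [Real.exp_neg, ← div_eq_mul_inv, le_div_iff₀ (Real.exp_pos _), le_div_iff₀ hc]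
    calc ‖x t‖ ^ 2 * Real.exp (q / C * t) * c = c * ‖x t‖ ^ 2 * Real.exp (q / C * t) := by ring
      _ ≤ V t * Real.exp (q / C * t) := by gcongr; exact hcP _
      _ ≤ V 0 := hV
  have hexp : Tendsto (fun t : ℝ => V 0 / c * Real.exp (-(q / C * t))) atTop (𝓝 0) := by
    simpa using (Real.tendsto_exp_neg_atTop_nhds_zero.comp
      (tendsto_id.const_mul_atTop (div_pos hq hC))).const_mul (V 0 / c)
  have hsq : Tendsto (fun t => ‖x t‖ ^ 2) atTop (𝓝 0) :=
    squeeze_zero' (Eventually.of_forall fun t => sq_nonneg _)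
      ((eventually_ge_atTop 0).mono hbound) hexp
  simpa [tendsto_zero_iff_norm_tendsto_zero] using hsq.sqrt

theorem IsPositiveStable.tendsto_dotProduct_mulVec {A : Matrix ι ι ℝ} (hA : IsPositiveStable A)
    {x y : ℝ → EuclideanSpace ℝ ι} (hx : IsTrajectory A x) (hy : IsTrajectory A y)
    (X : Matrix ι ι ℝ) : Tendsto (fun t => x t ⬝ᵥ X *ᵥ y t) atTop (𝓝 0) := by
  have hcont : Continuous fun p : EuclideanSpace ℝ ι × EuclideanSpace ℝ ι =>
      p.1 ⬝ᵥ X *ᵥ p.2 := by fun_prop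
  simpa [Function.comp_def] using (hcont.tendsto (0, 0)).comp
    ((hA.tendsto_zero hx).prodMk_nhds (hA.tendsto_zero hy))

theorem IsPositiveStable.eq_zero_of_lyapunov {A X : Matrix ι ι ℝ} (hA : IsPositiveStable A)
    (hX : A * X + X * Aᵀ = 0) : X = 0 := by
  classical
  ext i j
  obtain ⟨x, hx, hx0⟩ := exists_isTrajectory Aᵀ (EuclideanSpace.single i 1)
  obtain ⟨y, hy, hy0⟩ := exists_isTrajectory Aᵀ (EuclideanSpace.single j 1)
  have hderiv t : HasDerivAt (fun t => x t ⬝ᵥ X *ᵥ y t) 0 t := by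
    refine (hx.hasDerivAt_dotProduct_mulVec hy X t).congr_deriv ?_
    simp [Matrix.transpose_transpose, add_comm (X * Aᵀ), hX]
  have hconst t : x t ⬝ᵥ X *ᵥ y t = X i j := by
    rw [is_const_of_deriv_eq_zero (fun t => (hderiv t).differentiableAt)
      (fun t => (hderiv t).deriv) t 0, hx0, hy0]
    simp
  exact tendsto_nhds_unique (tendsto_const_nhds.congr fun t => (hconst t).symm)
    (hA.transpose.tendsto_dotProduct_mulVec hx hy X)

theorem IsPositiveStable.exists_lyapunov {A : Matrix ι ι ℝ} (hA : IsPositiveStable A)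
    (D : Matrix ι ι ℝ) : ∃ S, A * S + S * Aᵀ = D := by
  let lyapunov : Matrix ι ι ℝ →ₗ[ℝ] Matrix ι ι ℝ :=
    LinearMap.mulLeft ℝ A + LinearMap.mulRight ℝ Aᵀ
  have hinj : Function.Injective lyapunov :=
    (injective_iff_map_eq_zero lyapunov).2 fun _ hX => hA.eq_zero_of_lyapunov hX
  exact LinearMap.surjective_of_injective hinj D

theorem IsPositiveStable.posSemidef_of_lyapunov {A S D : Matrix ι ι ℝ} (hA : IsPositiveStable A)
    (hD : D.PosSemidef) (hS : A * S + S * Aᵀ = D) : S.PosSemidef := by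
  have hsymm : Sᵀ = S := by
    refine sub_eq_zero.1 (hA.eq_zero_of_lyapunov ?_)
    have hSt : A * Sᵀ + Sᵀ * Aᵀ = D := by
      rw [← hD.isHermitian.eq, ← hS]
      simp [add_comm]
    rw [mul_sub, sub_mul, sub_add_sub_comm, hSt, hS, sub_self]
  refine Matrix.PosSemidef.of_dotProduct_mulVec_nonneg hsymm fun v => ?_
  obtain ⟨x, hx, hx0⟩ := exists_isTrajectory Aᵀ (WithLp.toLp 2 v)
  have hanti : Antitone fun t => x t ⬝ᵥ S *ᵥ x t := by
    refine antitone_of_hasDerivAt_nonpos (hx.hasDerivAt_dotProduct_mulVec hx S) fun t => ?_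
    rw [Matrix.transpose_transpose, add_comm, hS]
    simpa using hD.dotProduct_mulVec_nonneg (x t).ofLp
  simpa [hx0] using hanti.le_of_tendsto (hA.transpose.tendsto_dotProduct_mulVec hx hx S) 0

end Stability

section SecondMoment

theorem exists_contDiff_deriv_nonpos_eq_zero_of_one_le :
    ∃ η : ℝ → ℝ, ContDiff ℝ ∞ η ∧ (∀ s, deriv η s ≤ 0) ∧ deriv η 0 = -1 ∧ ∀ s, 1 ≤ s → η s = 0 := by
  have hsmooth : ContDiff ℝ ∞ Real.smoothTransition := Real.smoothTransition.contDiff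
  obtain ⟨c, hc, hslope⟩ := exists_deriv_eq_slope Real.smoothTransition one_pos
    Real.smoothTransition.continuous.continuousOn
    (hsmooth.differentiable (by simp)).differentiableOn
  have hderiv s : deriv (fun s => Real.smoothTransition (c - s)) s =
      -deriv Real.smoothTransition (c - s) := deriv_comp_const_sub _ _ _
  refine ⟨fun s => Real.smoothTransition (c - s), by fun_prop, fun s => ?_, ?_, fun s hs => ?_⟩
  · rw [hderiv]
    exact neg_nonpos.2 Real.smoothTransition.monotone.deriv_nonneg
  · rw [hderiv, sub_zero, hslope]
    simp
  · exact Real.smoothTransition.zero_of_nonpos (by linarith [hc.2])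

theorem integrable_of_tendsto_of_integral_le {α : Type*} [MeasurableSpace α] {μ : Measure α}
    {f : ℕ → α → ℝ} {g : α → ℝ} {M : ℝ} (hf : ∀ n, Integrable (f n) μ) (hf0 : ∀ n x, 0 ≤ f n x)
    (hM : ∀ n, ∫ x, f n x ∂μ ≤ M) (hlim : ∀ x, Tendsto (fun n => f n x) atTop (𝓝 (g x))) :
    Integrable g μ := by
  have hmeas := fun n => (hf n).aestronglyMeasurable
  have hnorm n : eLpNorm (f n) 1 μ ≤ ENNReal.ofReal M := by
    rw [eLpNorm_one_eq_lintegral_enorm, ← ofReal_integral_norm_eq_lintegral_enorm (hf n)]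
    refine ENNReal.ofReal_le_ofReal ?_
    simpa only [Real.norm_of_nonneg (hf0 n _)] using hM n
  refine memLp_one_iff_integrable.1 ⟨aestronglyMeasurable_of_tendsto_ae atTop hmeas
    (ae_of_all _ hlim), ?_⟩
  calc eLpNorm g 1 μ ≤ liminf (fun n => eLpNorm (f n) 1 μ) atTop :=
        Lp.eLpNorm_lim_le_liminf_eLpNorm hmeas g (ae_of_all _ hlim)
    _ ≤ ENNReal.ofReal M := liminf_le_of_le (by isBoundedDefault) fun b hb =>
        hb.exists.elim fun n hn => hn.trans (hnorm n)
    _ < ⊤ := ENNReal.ofReal_lt_top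

variable {ι κ : Type*} [Fintype ι]

theorem hasCompactSupport_comp_dotProduct_mulVec {P : Matrix ι ι ℝ} (hP : P.PosDef) {η : ℝ → ℝ}
    (hη : ∀ s, 1 ≤ s → η s = 0) :
    HasCompactSupport fun z : EuclideanSpace ℝ ι => η (z ⬝ᵥ P *ᵥ z) := by
  obtain ⟨c, hc, hcP⟩ := exists_pos_mul_norm_sq_le_of_posDef hP
  refine HasCompactSupport.intro (isCompact_closedBall 0 (√c⁻¹)) fun z hz => hη _ ?_
  rw [mem_closedBall_zero_iff, not_le] at hz
  have hsq : c⁻¹ < ‖z‖ ^ 2 := (Real.sqrt_lt' ((Real.sqrt_nonneg _).trans_lt hz)).1 hz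
  calc 1 = c * c⁻¹ := (mul_inv_cancel₀ hc.ne').symm
    _ ≤ c * ‖z‖ ^ 2 := by gcongr
    _ ≤ z ⬝ᵥ P *ᵥ z := hcP z

variable [DecidableEq ι] [Fintype κ]

theorem fderiv_comp_dotProduct_mulVec_smul {η : ℝ → ℝ} (hη : Differentiable ℝ η)
    (P A : Matrix ι ι ℝ) (ε : ℝ) (z : EuclideanSpace ℝ ι) :
    fderiv ℝ (fun z : EuclideanSpace ℝ ι => η (z ⬝ᵥ P *ᵥ z)) (ε • z)
        (Matrix.toEuclideanCLM (𝕜 := ℝ) A (ε • z)) =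
      ε ^ 2 * (deriv η (ε ^ 2 * (z ⬝ᵥ P *ᵥ z)) * (z ⬝ᵥ (P * A + Aᵀ * P) *ᵥ z)) := by
  have hscale (X : Matrix ι ι ℝ) : (ε • z) ⬝ᵥ X *ᵥ (ε • z).ofLp = ε ^ 2 * (z ⬝ᵥ X *ᵥ z) := by
    simp only [WithLp.ofLp_smul, Matrix.mulVec_smul, dotProduct_smul, smul_dotProduct, smul_eq_mul]
    ring
  have hchain := ((hη ((ε • z) ⬝ᵥ P *ᵥ (ε • z).ofLp)).hasDerivAt.comp_hasFDerivAt (ε • z)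
    (hasFDerivAt_dotProduct_mulVec P (ε • z))).fderiv
  rw [Function.comp_def] at hchain
  rw [hchain, mul_left_comm, ← hscale, ← hscale, ← inner_add_transpose_mulVec]
  rfl

theorem IsStationarySolution.exists_abs_integral_fderiv_comp_smul_le
    {A : EuclideanSpace ℝ ι →L[ℝ] EuclideanSpace ℝ ι} {B : Matrix ι κ ℝ}
    {π : Measure (EuclideanSpace ℝ ι)} (hπ : IsStationarySolution A B π)
    {ψ : EuclideanSpace ℝ ι → ℝ} (hψ : ContDiff ℝ ∞ ψ) (hψs : HasCompactSupport ψ) :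
    ∃ M, ∀ ε : ℝ, ε ≠ 0 →
      Integrable (fun z => fderiv ℝ ψ (ε • z) (A (ε • z))) π ∧
        |∫ z, fderiv ℝ ψ (ε • z) (A (ε • z)) ∂π| ≤ ε ^ 2 * M := by
  obtain ⟨hprob, hzero⟩ := isStationarySolution_iff.1 hπ
  have hterm := continuous_diffusionTerm B hψ
  have hterms := hasCompactSupport_diffusionTerm B hψs
  have hdrift : Continuous fun w => fderiv ℝ ψ w (A w) :=
    (hψ.continuous_fderiv (by simp)).clm_apply A.continuous
  obtain ⟨M, hM⟩ := hterms.exists_bound_of_continuous hterm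
  refine ⟨M, fun ε hε => ?_⟩
  have hdrift_int : Integrable (fun z => fderiv ℝ ψ (ε • z) (A (ε • z))) π :=
    (hdrift.comp (continuous_const_smul ε)).integrable_of_hasCompactSupport
      ((hasCompactSupport_fderiv_apply A hψs).comp_smul hε)
  have hterm_int : Integrable (fun z => ε ^ 2 * diffusionTerm B ψ (ε • z)) π :=
    ((hterm.comp (continuous_const_smul ε)).integrable_of_hasCompactSupport
      (hterms.comp_smul hε)).const_mul _
  have hbalance : ∫ z, fderiv ℝ ψ (ε • z) (A (ε • z)) ∂π =
      ε ^ 2 * ∫ z, diffusionTerm B ψ (ε • z) ∂π := by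
    have h := hzero _ (contDiff_comp_smul hψ ε) (hψs.comp_smul hε)
    simp only [diffusionGenerator_comp_smul] at h
    rw [integral_sub hterm_int hdrift_int, integral_const_mul, sub_eq_zero] at h
    exact h.symm
  refine ⟨hdrift_int, ?_⟩
  rw [hbalance, abs_mul, abs_of_nonneg (sq_nonneg ε)]
  gcongr
  simpa using norm_integral_le_of_norm_le_const (μ := π) (ae_of_all _ fun z => hM (ε • z))

/-- The test functions are decreasing cutoffs `η (ε² V)` of the Lyapunov function `V z = z · P z`:
divided by `ε²`, the drift part of the generator is nonnegative with bounded integral, and as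
`ε → 0` it tends to the quadratic form in the conclusion. -/
theorem IsStationarySolution.integrable_dotProduct_mulVec {A : Matrix ι ι ℝ} {B : Matrix ι κ ℝ}
    {π : Measure (EuclideanSpace ℝ ι)}
    (hπ : IsStationarySolution (Matrix.toEuclideanCLM (𝕜 := ℝ) A) B π) {P : Matrix ι ι ℝ}
    (hP : P.PosDef) (hPA : (P * A + Aᵀ * P).PosSemidef) :
    Integrable (fun z : EuclideanSpace ℝ ι => z ⬝ᵥ (P * A + Aᵀ * P) *ᵥ z) π := by
  obtain ⟨η, hη, hη', hη0, hη1⟩ := exists_contDiff_deriv_nonpos_eq_zero_of_one_le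
  have hηc : Continuous (deriv η) := (contDiff_infty_iff_deriv.1 hη).2.continuous
  have hV : ContDiff ℝ ∞ fun z : EuclideanSpace ℝ ι => z ⬝ᵥ P *ᵥ z := by
    simp only [dotProduct, Matrix.mulVec]
    fun_prop
  obtain ⟨M, hM⟩ := hπ.exists_abs_integral_fderiv_comp_smul_le (hη.comp hV)
    (hasCompactSupport_comp_dotProduct_mulVec hP hη1)
  simp only [Function.comp_def, fderiv_comp_dotProduct_mulVec_smul
    (hη.differentiable (by simp))] at hM
  let ε (n : ℕ) : ℝ := 1 / (n + 1)
  have hε n : ε n ≠ 0 := Nat.one_div_pos_of_nat.ne'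
  refine integrable_of_tendsto_of_integral_le (M := M) (f := fun n (z : EuclideanSpace ℝ ι) =>
    -(deriv η (ε n ^ 2 * (z ⬝ᵥ P *ᵥ z)) * (z ⬝ᵥ (P * A + Aᵀ * P) *ᵥ z)))
    (fun n => ?_) (fun n z => ?_) (fun n => ?_) fun z => ?_
  · refine ((hM (ε n) (hε n)).1.const_mul (-(ε n ^ 2)⁻¹)).congr (ae_of_all _ fun z => ?_)
    simp [hε n]
  · exact neg_nonneg.2 (mul_nonpos_of_nonpos_of_nonneg (hη' _)
      (by simpa using hPA.dotProduct_mulVec_nonneg z.ofLp))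
  · have h := (hM (ε n) (hε n)).2
    rw [integral_const_mul, abs_mul, abs_of_nonneg (sq_nonneg _),
      mul_le_mul_iff_right₀ (sq_pos_of_ne_zero (hε n))] at h
    rw [integral_neg]
    exact (neg_le_abs _).trans h
  · have hlim : Tendsto ε atTop (𝓝 0) := tendsto_one_div_add_atTop_nhds_zero_nat
    have hcont : Continuous fun ε : ℝ =>
        -(deriv η (ε ^ 2 * (z ⬝ᵥ P *ᵥ z)) * (z ⬝ᵥ (P * A + Aᵀ * P) *ᵥ z)) := by fun_prop
    simpa [hη0, Function.comp_def] using (hcont.tendsto 0).comp hlim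

theorem IsStationarySolution.integrable_norm_sq {A : Matrix ι ι ℝ} (hA : IsPositiveStable A)
    {B : Matrix ι κ ℝ} {π : Measure (EuclideanSpace ℝ ι)}
    (hπ : IsStationarySolution (Matrix.toEuclideanCLM (𝕜 := ℝ) A) B π) :
    Integrable (fun z => ‖z‖ ^ 2) π := by
  obtain ⟨P, hP, hPA⟩ := hA
  obtain ⟨q, hq, hqPA⟩ := exists_pos_mul_norm_sq_le_of_posDef hPA
  refine ((hπ.integrable_dotProduct_mulVec hP hPA.posSemidef).const_mul q⁻¹).mono' (by fun_prop)
    (ae_of_all _ fun z => ?_)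
  rw [Real.norm_of_nonneg (sq_nonneg _), inv_mul_eq_div, le_div_iff₀' hq]
  exact hqPA z

theorem IsStationarySolution.integrable_norm {A : Matrix ι ι ℝ} (hA : IsPositiveStable A)
    {B : Matrix ι κ ℝ} {π : Measure (EuclideanSpace ℝ ι)}
    (hπ : IsStationarySolution (Matrix.toEuclideanCLM (𝕜 := ℝ) A) B π) :
    Integrable (fun z => ‖z‖) π := by
  have := hπ.isProbabilityMeasure
  refine (((memLp_two_iff_integrable_sq (by fun_prop)).2 (hπ.integrable_norm_sq hA)).integrable
    one_le_two)

end SecondMoment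

section GaussianIntegrationByParts

variable {E : Type*} [NormedAddCommGroup E] [NormedSpace ℝ E] {ψ : E → ℝ} {K : ℝ}

theorem hasDerivAt_comp_rotation_fst (hψ : Differentiable ℝ ψ) (p : E × E) (θ : ℝ) :
    HasDerivAt (fun θ => ψ (ContinuousLinearMap.rotation θ p).1)
      (fderiv ℝ ψ (ContinuousLinearMap.rotation θ p).1 (ContinuousLinearMap.rotation θ p).2) θ :=
  (hψ _).hasFDerivAt.comp_hasDerivAt θ
    (((Real.hasDerivAt_cos θ).smul_const p.1).add ((Real.hasDerivAt_sin θ).smul_const p.2))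

theorem norm_rotation_snd_le (p : E × E) (θ : ℝ) :
    ‖(ContinuousLinearMap.rotation θ p).2‖ ≤ ‖p.1‖ + ‖p.2‖ := by
  refine (norm_add_le _ _).trans ?_
  rw [norm_smul, norm_smul, norm_neg]
  exact add_le_add (mul_le_of_le_one_left (norm_nonneg _) (Real.abs_sin_le_one θ))
    (mul_le_of_le_one_left (norm_nonneg _) (Real.abs_cos_le_one θ))

variable [MeasurableSpace E] [BorelSpace E] {μ : Measure E}

theorem memLp_two_of_norm_fderiv_le [IsFiniteMeasure μ] (hμ : MemLp id 2 μ)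
    (hψ : ContDiff ℝ 1 ψ) (hK : ∀ x, ‖fderiv ℝ ψ x‖ ≤ K) : MemLp ψ 2 μ := by
  refine ((memLp_const ‖ψ 0‖).add (hμ.norm.const_mul K)).mono'
    hψ.continuous.aestronglyMeasurable (ae_of_all _ fun x => ?_)
  have hlip := convex_univ.norm_image_sub_le_of_norm_fderiv_le (f := ψ) (𝕜 := ℝ)
    (fun x _ => hψ.differentiable one_ne_zero x) (fun x _ => hK x) (mem_univ 0) (mem_univ x)
  rw [sub_zero] at hlip
  calc ‖ψ x‖ ≤ ‖ψ 0‖ + ‖ψ x - ψ 0‖ := norm_le_norm_add_norm_sub' _ _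
    _ ≤ ‖ψ 0‖ + K * ‖x‖ := by gcongr

variable [SecondCountableTopology E]

theorem integral_comp_rotation_mul_dual [IsProbabilityMeasure μ]
    (hμ : ∀ θ, (μ.prod μ).map (ContinuousLinearMap.rotation θ) = μ.prod μ) {L : StrongDual ℝ E}
    (hL : Integrable L μ) (hL0 : ∫ x, L x ∂μ = 0) (hψ : Integrable ψ μ)
    (hψL : Integrable (fun x => ψ x * L x) μ) (θ : ℝ) :
    ∫ p, ψ (ContinuousLinearMap.rotation θ p).1 * L p.2 ∂μ.prod μ =
      Real.sin θ * ∫ x, ψ x * L x ∂μ := by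
  have hinverse (p : E × E) : L p.2 =
      Real.sin θ * L (ContinuousLinearMap.rotation θ p).1 +
        Real.cos θ * L (ContinuousLinearMap.rotation θ p).2 := by
    simp only [ContinuousLinearMap.rotation_apply, map_add, map_smul, smul_eq_mul]
    linear_combination -L p.2 * Real.sin_sq_add_cos_sq θ
  have hfst : Integrable (fun p : E × E => Real.sin θ * (ψ p.1 * L p.1)) (μ.prod μ) :=
    (hψL.comp_fst μ).const_mul _
  have hprod : Integrable (fun p : E × E => Real.cos θ * (ψ p.1 * L p.2)) (μ.prod μ) :=
    (hψ.mul_prod hL).const_mul _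
  calc ∫ p, ψ (ContinuousLinearMap.rotation θ p).1 * L p.2 ∂μ.prod μ
      = ∫ p, Real.sin θ * (ψ p.1 * L p.1) + Real.cos θ * (ψ p.1 * L p.2)
          ∂(μ.prod μ).map (ContinuousLinearMap.rotation θ) := by
        rw [integral_map (by fun_prop) (by rw [hμ]; exact (hfst.add hprod).aestronglyMeasurable)]
        refine integral_congr_ae (ae_of_all _ fun p => ?_)
        simp only [hinverse p]
        ring
    _ = Real.sin θ * ∫ x, ψ x * L x ∂μ := by
        rw [hμ, integral_add hfst hprod, integral_const_mul, integral_const_mul,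
          integral_prod_mul, hL0, integral_fun_fst (fun x => ψ x * L x)]
        simp

theorem hasDerivAt_integral_comp_rotation_mul_dual [IsFiniteMeasure μ] (hμ : MemLp id 2 μ)
    (hψ : ContDiff ℝ 1 ψ) (hK : ∀ x, ‖fderiv ℝ ψ x‖ ≤ K) (L : StrongDual ℝ E) :
    Integrable (fun p : E × E => fderiv ℝ ψ p.1 p.2 * L p.2) (μ.prod μ) ∧
    HasDerivAt (fun θ => ∫ p, ψ (ContinuousLinearMap.rotation θ p).1 * L p.2 ∂μ.prod μ)
      (∫ p, fderiv ℝ ψ p.1 p.2 * L p.2 ∂μ.prod μ) 0 := by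
  have hψc : Continuous ψ := hψ.continuous
  have : Continuous (fderiv ℝ ψ) := hψ.continuous_fderiv one_ne_zero
  have hnorm : Integrable (fun x => ‖x‖) μ := hμ.norm.integrable one_le_two
  have hsq : Integrable (fun x => ‖x‖ ^ 2) μ := hμ.integrable_norm_pow two_ne_zero
  have hK0 : 0 ≤ K := (norm_nonneg _).trans (hK 0)
  have hrot0 (p : E × E) : ContinuousLinearMap.rotation 0 p = p := by
    simp [ContinuousLinearMap.rotation_apply]
  have hbound (p : E × E) θ : ‖fderiv ℝ ψ (ContinuousLinearMap.rotation θ p).1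
      (ContinuousLinearMap.rotation θ p).2 * L p.2‖ ≤
      K * ‖L‖ * (‖p.1‖ * ‖p.2‖ + ‖p.2‖ ^ 2) :=
    calc _ ≤ K * (‖p.1‖ + ‖p.2‖) * (‖L‖ * ‖p.2‖) := by
          rw [norm_mul]
          gcongr
          exacts [(ContinuousLinearMap.le_of_opNorm_le _ (hK _) _).trans
            (mul_le_mul_of_nonneg_left (norm_rotation_snd_le p θ) hK0), L.le_opNorm _]
      _ = _ := by ring
  have hint : Integrable (fun p : E × E => ψ p.1 * L p.2) (μ.prod μ) :=
    ((memLp_two_of_norm_fderiv_le hμ hψ hK).integrable one_le_two).mul_prod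
      (L.integrable_comp (hμ.integrable one_le_two))
  simpa only [hrot0] using hasDerivAt_integral_of_dominated_loc_of_deriv_le (x₀ := 0) univ_mem
    (F := fun θ p => ψ (ContinuousLinearMap.rotation θ p).1 * L p.2)
    (F' := fun θ p => fderiv ℝ ψ (ContinuousLinearMap.rotation θ p).1
      (ContinuousLinearMap.rotation θ p).2 * L p.2)
    (Eventually.of_forall fun θ => Continuous.aestronglyMeasurable (by fun_prop))
    (by simpa only [hrot0] using hint) (Continuous.aestronglyMeasurable (by fun_prop))
    (ae_of_all _ fun p θ _ => hbound p θ)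
    (((hnorm.mul_prod hnorm).add (hsq.comp_snd μ)).const_mul _)
    (ae_of_all _ fun p θ _ =>
      (hasDerivAt_comp_rotation_fst (hψ.differentiable one_ne_zero) p θ).mul_const _)

/-- Gaussian integration by parts. Differentiate at `θ = 0` the identity
`𝔼[ψ(X cos θ + Y sin θ) L(Y)] = sin θ * 𝔼[ψ(X) L(X)]`, which expresses the rotation invariance of
the law of two independent copies `X`, `Y`. -/
theorem integral_mul_dual_eq_integral_covarianceBilinDual_fderiv [CompleteSpace E] [IsGaussian μ]
    (hμ : μ[id] = 0) (hψ : ContDiff ℝ 1 ψ) (hK : ∀ x, ‖fderiv ℝ ψ x‖ ≤ K) (L : StrongDual ℝ E) :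
    ∫ x, ψ x * L x ∂μ = ∫ x, covarianceBilinDual μ L (fderiv ℝ ψ x) ∂μ := by
  have hμ2 : MemLp id 2 μ := IsGaussian.memLp_two_id
  have hψ2 : MemLp ψ 2 μ := memLp_two_of_norm_fderiv_le hμ2 hψ hK
  have hL0 : ∫ x, L x ∂μ = 0 := by
    rw [← map_zero L, ← hμ]
    exact L.integral_comp_comm IsGaussian.integrable_id
  obtain ⟨hint, hderiv⟩ := hasDerivAt_integral_comp_rotation_mul_dual hμ2 hψ hK L
  simp only [integral_comp_rotation_mul_dual (IsGaussian.map_rotation_eq_self hμ)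
    (L.integrable_comp IsGaussian.integrable_id) hL0 (hψ2.integrable one_le_two)
    (hψ2.integrable_mul (L.comp_memLp' hμ2))] at hderiv
  have hsin := (Real.hasDerivAt_sin 0).mul_const (∫ x, ψ x * L x ∂μ)
  rw [Real.cos_zero, one_mul] at hsin
  rw [hsin.unique hderiv, integral_prod _ hint]
  simp only [covarianceBilinDual_apply' hμ2, hμ, sub_zero, mul_comm]

end GaussianIntegrationByParts

section GaussianStationary

variable {ι κ : Type*} [Fintype ι] [DecidableEq ι] [Fintype κ] {A S : Matrix ι ι ℝ}
  {B : Matrix ι κ ℝ} {φ ψ : EuclideanSpace ℝ ι → ℝ}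

theorem partialDeriv_comm (hφ : ContDiff ℝ ∞ φ) (i j : ι) :
    partialDeriv i (partialDeriv j φ) = partialDeriv j (partialDeriv i φ) := by
  have hdiff : Differentiable ℝ (fderiv ℝ φ) :=
    (hφ.fderiv_right (m := ∞) (by simp)).differentiable (by simp)
  have hsecond i j z : partialDeriv i (partialDeriv j φ) z =
      fderiv ℝ (fderiv ℝ φ) z (EuclideanSpace.single i 1) (EuclideanSpace.single j 1) := by
    change fderiv ℝ (fun w => fderiv ℝ φ w (EuclideanSpace.single j 1)) z _ = _
    rw [fderiv_clm_apply (hdiff z) (differentiableAt_const _)]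
    simp
  ext z
  rw [hsecond, hsecond]
  refine (hφ.contDiffAt.isSymmSndFDerivAt ?_) _ _
  rw [minSmoothness_of_isRCLikeNormedField]
  exact WithTop.coe_le_coe.2 le_top

theorem integral_mul_apply_multivariateGaussian (hS : S.PosSemidef) (hψ : ContDiff ℝ ∞ ψ)
    (hψs : HasCompactSupport ψ) (i : ι) :
    ∫ z, ψ z * z i ∂multivariateGaussian 0 S =
      ∑ j, S i j * ∫ z, partialDeriv j ψ z ∂multivariateGaussian 0 S := by
  have hψ' : Continuous (fderiv ℝ ψ) := hψ.continuous_fderiv (by simp)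
  obtain ⟨K, hK⟩ := (hψs.fderiv (𝕜 := ℝ)).exists_bound_of_continuous hψ'
  have hfderiv z : fderiv ℝ ψ z = ∑ j, partialDeriv j ψ z • EuclideanSpace.proj (𝕜 := ℝ) j := by
    ext v
    simp [fderiv_apply_eq_sum_partialDeriv, mul_comm]
  have hcov j : covarianceBilinDual (multivariateGaussian 0 S) (EuclideanSpace.proj i)
      (EuclideanSpace.proj j) = S i j := by
    rw [covarianceBilinDual_eq_covariance IsGaussian.memLp_two_id]
    exact covariance_eval_multivariateGaussian hS i j
  have hint j : Integrable (partialDeriv j ψ) (multivariateGaussian 0 S) :=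
    (contDiff_partialDeriv hψ j).continuous.integrable_of_hasCompactSupport
      (hasCompactSupport_partialDeriv hψs j)
  calc ∫ z, ψ z * z i ∂multivariateGaussian 0 S
      = ∫ z, covarianceBilinDual (multivariateGaussian 0 S) (EuclideanSpace.proj i)
          (fderiv ℝ ψ z) ∂multivariateGaussian 0 S :=
        integral_mul_dual_eq_integral_covarianceBilinDual_fderiv integral_id_multivariateGaussian'
          (hψ.of_le (by simp)) hK (EuclideanSpace.proj i)
    _ = ∫ z, ∑ j, S i j * partialDeriv j ψ z ∂multivariateGaussian 0 S := by
        simp only [hfderiv, map_sum, map_smul, hcov, smul_eq_mul, mul_comm]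
    _ = _ := by
        rw [integral_finsetSum _ fun j _ => (hint j).const_mul _]
        simp only [integral_const_mul]

theorem integral_fderiv_toEuclideanCLM_multivariateGaussian (hS : S.PosSemidef)
    (A : Matrix ι ι ℝ) (hφ : ContDiff ℝ ∞ φ) (hφs : HasCompactSupport φ) :
    ∫ z, fderiv ℝ φ z (Matrix.toEuclideanCLM (𝕜 := ℝ) A z) ∂multivariateGaussian 0 S =
      ∑ i, ∑ j, (A * S) i j *
        ∫ z, partialDeriv i (partialDeriv j φ) z ∂multivariateGaussian 0 S := by
  have hint i k : Integrable (fun z : EuclideanSpace ℝ ι => A i k * (partialDeriv i φ z * z k))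
      (multivariateGaussian 0 S) :=
    (((contDiff_partialDeriv hφ i).continuous.mul
      (by fun_prop)).integrable_of_hasCompactSupport
      (hasCompactSupport_partialDeriv hφs i).mul_right).const_mul _
  calc _ = ∫ z, ∑ i, ∑ k, A i k * (partialDeriv i φ z * z k) ∂multivariateGaussian 0 S := by
        refine integral_congr_ae (ae_of_all _ fun z => ?_)
        simp only [fderiv_apply_eq_sum_partialDeriv, Matrix.ofLp_toEuclideanCLM, Matrix.mulVec,
          dotProduct, Finset.sum_mul, mul_assoc, mul_comm (partialDeriv _ φ z)]
    _ = ∑ i, ∑ k, A i k * ∑ j, S k j *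
          ∫ z, partialDeriv j (partialDeriv i φ) z ∂multivariateGaussian 0 S := by
        rw [integral_finsetSum _ fun i _ => integrable_finsetSum _ fun k _ => hint i k]
        simp only [integral_finsetSum _ fun k _ => hint _ k, integral_const_mul,
          integral_mul_apply_multivariateGaussian hS (contDiff_partialDeriv hφ _)
            (hasCompactSupport_partialDeriv hφs _)]
    _ = _ := by
        refine Finset.sum_congr rfl fun i _ => ?_
        simp only [Matrix.mul_apply, Finset.sum_mul, Finset.mul_sum, mul_assoc,
          fun j => partialDeriv_comm hφ j i]
        exact Finset.sum_comm

theorem integral_diffusionTerm {μ : Measure (EuclideanSpace ℝ ι)} [IsFiniteMeasureOnCompacts μ]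
    (B : Matrix ι κ ℝ) (hφ : ContDiff ℝ ∞ φ) (hφs : HasCompactSupport φ) :
    ∫ z, diffusionTerm B φ z ∂μ =
      ∑ i, ∑ j, ((1 / 2 : ℝ) • (B * Bᵀ)) i j * ∫ z, partialDeriv i (partialDeriv j φ) z ∂μ := by
  have hint i j : Integrable (fun z => ((1 / 2 : ℝ) • (B * Bᵀ)) i j *
      partialDeriv i (partialDeriv j φ) z) μ :=
    ((contDiff_partialDeriv (contDiff_partialDeriv hφ j) i).continuous
      |>.integrable_of_hasCompactSupport
        (hasCompactSupport_partialDeriv (hasCompactSupport_partialDeriv hφs j) i)).const_mul _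
  simp only [diffusionTerm]
  rw [integral_finsetSum _ fun i _ => integrable_finsetSum _ fun j _ => hint i j]
  simp only [integral_finsetSum _ fun j _ => hint _ j, integral_const_mul]

theorem isStationarySolution_multivariateGaussian (hS : S.PosSemidef)
    (hAS : A * S + S * Aᵀ = B * Bᵀ) :
    IsStationarySolution (Matrix.toEuclideanCLM (𝕜 := ℝ) A) B (multivariateGaussian 0 S) := by
  refine isStationarySolution_iff.2 ⟨inferInstance, fun φ hφ hφs => ?_⟩
  set H : ι → ι → ℝ := fun i j =>
    ∫ z, partialDeriv i (partialDeriv j φ) z ∂multivariateGaussian 0 S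
  have hH i j : H j i = H i j := by simp only [H, partialDeriv_comm hφ i j]
  have hterm : Integrable (diffusionTerm B φ) (multivariateGaussian 0 S) :=
    (continuous_diffusionTerm B hφ).integrable_of_hasCompactSupport
      (hasCompactSupport_diffusionTerm B hφs)
  have hdrift : Integrable (fun z => fderiv ℝ φ z (Matrix.toEuclideanCLM (𝕜 := ℝ) A z))
      (multivariateGaussian 0 S) :=
    ((hφ.continuous_fderiv (by simp)).clm_apply
      (by fun_prop)).integrable_of_hasCompactSupport (hasCompactSupport_fderiv_apply _ hφs)
  have hSA : S * Aᵀ = (A * S)ᵀ := by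
    rw [Matrix.transpose_mul, show Sᵀ = S from hS.isHermitian]
  have htranspose : ∑ i, ∑ j, (A * S) j i * H i j = ∑ i, ∑ j, (A * S) i j * H i j := by
    rw [Finset.sum_comm]
    simp only [hH]
  simp only [diffusionGenerator_eq]
  rw [integral_sub hterm hdrift, integral_fderiv_toEuclideanCLM_multivariateGaussian hS A hφ hφs,
    integral_diffusionTerm B hφ hφs, sub_eq_zero, ← hAS, hSA]
  calc ∑ i, ∑ j, ((1 / 2 : ℝ) • (A * S + (A * S)ᵀ)) i j * H i j
      = 1 / 2 * (∑ i, ∑ j, (A * S) i j * H i j + ∑ i, ∑ j, (A * S) j i * H i j) := by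
        simp only [Matrix.smul_apply, Matrix.add_apply, Matrix.transpose_apply, smul_eq_mul,
          mul_assoc, add_mul, ← Finset.mul_sum, Finset.sum_add_distrib]
    _ = ∑ i, ∑ j, (A * S) i j * H i j := by
        rw [htranspose]
        ring

end GaussianStationary

section CharFun

variable {ι : Type*} [Fintype ι] {π : Measure (EuclideanSpace ℝ ι)}

theorem integrable_comp_inner [IsFiniteMeasure π] {θ : ℝ → ℝ} {G : ℝ} (hθ : Continuous θ)
    (hG : ∀ s, |θ s| ≤ G) (ξ : EuclideanSpace ℝ ι) : Integrable (fun z => θ (inner ℝ ξ z)) π :=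
  .of_bound (by fun_prop) G (ae_of_all _ fun z => hG _)

theorem integrable_comp_inner_mul_inner {A : EuclideanSpace ℝ ι →L[ℝ] EuclideanSpace ℝ ι}
    (hnorm : Integrable (fun z => ‖z‖) π) {θ : ℝ → ℝ} {G : ℝ} (hθ : Continuous θ)
    (hG : ∀ s, |θ s| ≤ G) (ξ : EuclideanSpace ℝ ι) :
    Integrable (fun z => θ (inner ℝ ξ z) * inner ℝ ξ (A z)) π := by
  refine (hnorm.const_mul (G * (‖ξ‖ * ‖A‖))).mono' (by fun_prop) (ae_of_all _ fun z => ?_)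
  have hA : ‖inner ℝ ξ (A z)‖ ≤ ‖ξ‖ * (‖A‖ * ‖z‖) :=
    (norm_inner_le_norm _ _).trans (by gcongr; exact A.le_opNorm z)
  rw [norm_mul, mul_assoc, mul_assoc]
  exact mul_le_mul (hG _) hA (norm_nonneg _) ((abs_nonneg _).trans (hG 0))

variable {κ : Type*} [DecidableEq ι] [Fintype κ] {B : Matrix ι κ ℝ}

theorem diffusionGenerator_comp_inner (A : EuclideanSpace ℝ ι → EuclideanSpace ℝ ι)
    (B : Matrix ι κ ℝ) {θ : ℝ → ℝ} (hθ : ContDiff ℝ ∞ θ) (ξ z : EuclideanSpace ℝ ι) :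
    diffusionGenerator A B (fun z => θ (inner ℝ ξ z)) z =
      deriv (deriv θ) (inner ℝ ξ z) * (ξ ⬝ᵥ (B * Bᵀ) *ᵥ ξ / 2) -
        deriv θ (inner ℝ ξ z) * inner ℝ ξ (A z) := by
  rw [diffusionGenerator_eq, diffusionTerm_comp_inner B hθ,
    (hasFDerivAt_comp_inner (hθ.differentiable (by simp)) ξ z).fderiv]
  simp

theorem IsStationarySolution.integral_deriv_comp_inner_mul_inner
    {A : EuclideanSpace ℝ ι →L[ℝ] EuclideanSpace ℝ ι} (hπ : IsStationarySolution A B π)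
    (hnorm : Integrable (fun z => ‖z‖) π) {θ : ℝ → ℝ} {G : ℝ} (hθ : ContDiff ℝ ∞ θ)
    (hG : ∀ s, |θ s| ≤ G) (hG' : ∀ s, |deriv θ s| ≤ G) (hG'' : ∀ s, |deriv (deriv θ) s| ≤ G)
    (ξ : EuclideanSpace ℝ ι) :
    ∫ z, deriv θ (inner ℝ ξ z) * inner ℝ ξ (A z) ∂π =
      (ξ ⬝ᵥ (B * Bᵀ) *ᵥ ξ / 2) * ∫ z, deriv (deriv θ) (inner ℝ ξ z) ∂π := by
  have := hπ.isProbabilityMeasure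
  have hθ' : ContDiff ℝ ∞ (deriv θ) := (contDiff_infty_iff_deriv.1 hθ).2
  have hθc'' := (contDiff_infty_iff_deriv.1 hθ').2.continuous
  have hdrift := integrable_comp_inner_mul_inner (A := A) hnorm hθ'.continuous hG' ξ
  have hterm : Integrable
      (fun z => deriv (deriv θ) (inner ℝ ξ z) * (ξ ⬝ᵥ (B * Bᵀ) *ᵥ ξ / 2)) π :=
    (integrable_comp_inner hθc'' hG'' ξ).mul_const _
  have hpartial i z : |partialDeriv i (fun z => θ (inner ℝ ξ z)) z| ≤ ‖ξ‖ * G := by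
    rw [partialDeriv_comp_inner (hθ.differentiable (by simp)), abs_mul]
    exact mul_le_mul (PiLp.norm_apply_le ξ i) (hG' _) (abs_nonneg _) (norm_nonneg _)
  have hzero := hπ.integral_diffusionGenerator_eq_zero (G := max G (‖ξ‖ * G))
    (hθ.comp (contDiff_const.inner ℝ contDiff_id)) (fun z => (hG _).trans (le_max_left _ _))
    (fun i z => (hpartial i z).trans (le_max_right _ _))
    ((hterm.sub hdrift).congr
      (ae_of_all _ fun z => (diffusionGenerator_comp_inner A B hθ ξ z).symm))
  simp only [Function.comp_def, id, diffusionGenerator_comp_inner _ B hθ] at hzero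
  rw [integral_sub hterm hdrift, integral_mul_const] at hzero
  linarith

theorem IsStationarySolution.integral_cexp_inner_mul_inner
    {A : EuclideanSpace ℝ ι →L[ℝ] EuclideanSpace ℝ ι} (hπ : IsStationarySolution A B π)
    (hnorm : Integrable (fun z => ‖z‖) π) (ξ : EuclideanSpace ℝ ι) :
    ∫ z, Complex.exp (inner ℝ z ξ * Complex.I) * (inner ℝ ξ (A z) : ℝ) ∂π =
      (ξ ⬝ᵥ (B * Bᵀ) *ᵥ ξ / 2 : ℝ) * Complex.I * charFun π ξ := by
  have := hπ.isProbabilityMeasure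
  have hcos := integrable_comp_inner (π := π) Real.continuous_cos Real.abs_cos_le_one ξ
  have hsin := integrable_comp_inner (π := π) Real.continuous_sin Real.abs_sin_le_one ξ
  have hcosA := integrable_comp_inner_mul_inner (A := A) hnorm Real.continuous_cos
    Real.abs_cos_le_one ξ
  have hsinA := integrable_comp_inner_mul_inner (A := A) hnorm Real.continuous_sin
    Real.abs_sin_le_one ξ
  have hcos_eq := hπ.integral_deriv_comp_inner_mul_inner hnorm (G := 1)
    Real.contDiff_sin Real.abs_sin_le_one (by simp [Real.abs_cos_le_one])
    (by simp [Real.abs_sin_le_one]) ξ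
  have hsin_eq := hπ.integral_deriv_comp_inner_mul_inner hnorm (G := 1)
    Real.contDiff_cos Real.abs_cos_le_one (by simp [Real.abs_sin_le_one])
    (by simp [Real.abs_cos_le_one]) ξ
  simp only [Real.deriv_sin, Real.deriv_cos', deriv.fun_neg', integral_neg, neg_mul, mul_neg,
    neg_inj] at hcos_eq hsin_eq
  have hexp z : Complex.exp (inner ℝ z ξ * Complex.I) =
      Real.cos (inner ℝ ξ z) + Real.sin (inner ℝ ξ z) * Complex.I := by
    rw [Complex.exp_mul_I, real_inner_comm]
    push_cast
    rfl
  have hexpA z : Complex.exp (inner ℝ z ξ * Complex.I) * (inner ℝ ξ (A z) : ℝ) =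
      (Real.cos (inner ℝ ξ z) * inner ℝ ξ (A z) : ℝ) +
        (Real.sin (inner ℝ ξ z) * inner ℝ ξ (A z) : ℝ) * Complex.I := by
    rw [hexp]
    push_cast
    ring
  simp only [hexpA]
  rw [integral_add hcosA.ofReal (hsinA.ofReal.mul_const _), charFun_apply]
  simp only [hexp]
  rw [integral_add hcos.ofReal (hsin.ofReal.mul_const _)]
  simp only [integral_mul_const, integral_complex_ofReal, hcos_eq, hsin_eq]
  push_cast
  linear_combination (norm := ring_nf) -((ξ ⬝ᵥ (B * Bᵀ) *ᵥ ξ : ℝ) / 2 : ℂ) *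
    (∫ z, Real.sin (inner ℝ ξ z) ∂π : ℝ) * Complex.I_sq

theorem IsStationarySolution.hasDerivAt_charFun_comp {A : Matrix ι ι ℝ}
    (hπ : IsStationarySolution (Matrix.toEuclideanCLM (𝕜 := ℝ) A) B π)
    (hnorm : Integrable (fun z => ‖z‖) π) {x : ℝ → EuclideanSpace ℝ ι}
    (hx : IsTrajectory Aᵀ x) (t : ℝ) :
    HasDerivAt (fun t => charFun π (x t))
      ((x t ⬝ᵥ (B * Bᵀ) *ᵥ x t / 2 : ℝ) * charFun π (x t)) t := by
  have := hπ.isProbabilityMeasure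
  have hmem : MemLp id (1 : ℕ) π := by
    rw [Nat.cast_one, memLp_one_iff_integrable]
    exact (integrable_norm_iff (by fun_prop)).1 hnorm
  have hcharFun : HasFDerivAt (charFun π) (fderiv ℝ (charFun π) (x t)) (x t) :=
    ((contDiff_charFun hmem).differentiable (by simp) _).hasFDerivAt
  have hinner z : inner ℝ z (WithLp.toLp 2 (-(Aᵀ *ᵥ x t))) =
      -inner ℝ (x t) (Matrix.toEuclideanCLM (𝕜 := ℝ) A z) := by
    simp [EuclideanSpace.inner_eq_star_dotProduct, Matrix.mulVec_transpose,
      ← Matrix.dotProduct_mulVec, dotProduct_comm (A *ᵥ _)]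
  refine (hcharFun.comp_hasDerivAt t (hx t)).congr_deriv ?_
  calc fderiv ℝ (charFun π) (x t) (WithLp.toLp 2 (-(Aᵀ *ᵥ x t)))
      = Complex.I * ∫ z, (inner ℝ z (WithLp.toLp 2 (-(Aᵀ *ᵥ x t))) : ℝ) *
          Complex.exp (inner ℝ z (x t) * Complex.I) ∂π := by
        simpa [iteratedFDeriv_one_apply] using
          iteratedFDeriv_charFun hmem fun _ : Fin 1 => WithLp.toLp 2 (-(Aᵀ *ᵥ x t))
    _ = -Complex.I * ∫ z, Complex.exp (inner ℝ z (x t) * Complex.I) *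
          (inner ℝ (x t) (Matrix.toEuclideanCLM (𝕜 := ℝ) A z) : ℝ) ∂π := by
        simp only [hinner, Complex.ofReal_neg, neg_mul, integral_neg, mul_neg, mul_comm]
    _ = (x t ⬝ᵥ (B * Bᵀ) *ᵥ x t / 2 : ℝ) * charFun π (x t) := by
        rw [hπ.integral_cexp_inner_mul_inner hnorm]
        linear_combination -((x t ⬝ᵥ (B * Bᵀ) *ᵥ x t / 2 : ℝ) : ℂ) * charFun π (x t) *
          Complex.I_sq

/-- Along the flow of `Aᵀ` the characteristic function of a stationary solution satisfies a scalar
linear equation, and it tends to `1` because the flow is stable. -/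
theorem IsStationarySolution.charFun_eq {A S : Matrix ι ι ℝ} (hA : IsPositiveStable A)
    (hS : A * S + S * Aᵀ = B * Bᵀ)
    (hπ : IsStationarySolution (Matrix.toEuclideanCLM (𝕜 := ℝ) A) B π) (ξ : EuclideanSpace ℝ ι) :
    charFun π ξ = Complex.exp (-(ξ ⬝ᵥ S *ᵥ ξ / 2 : ℝ)) := by
  have := hπ.isProbabilityMeasure
  obtain ⟨x, hx, hx0⟩ := exists_isTrajectory Aᵀ ξ
  let F : ℝ → ℂ := fun t => charFun π (x t) * Complex.exp (x t ⬝ᵥ S *ᵥ x t / 2 : ℝ)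
  have hderiv t : HasDerivAt F 0 t := by
    refine ((hπ.hasDerivAt_charFun_comp (hπ.integrable_norm hA) hx t).mul
      ((hx.hasDerivAt_dotProduct_mulVec hx S t).div_const 2).ofReal_comp.cexp).congr_deriv ?_
    rw [Matrix.transpose_transpose, add_comm (S * Aᵀ), hS]
    push_cast
    ring
  have hconst t : F t = F 0 := is_const_of_deriv_eq_zero
    (fun t => (hderiv t).differentiableAt) (fun t => (hderiv t).deriv) t 0
  have hlim : Tendsto F atTop (𝓝 1) := by
    have hchar := ((continuous_charFun (μ := π)).tendsto 0).comp (hA.transpose.tendsto_zero hx)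
    have hquad := (hA.transpose.tendsto_dotProduct_mulVec hx hx S).div_const 2
    simpa [F] using hchar.mul (Complex.continuous_exp.tendsto _ |>.comp
      ((Complex.continuous_ofReal.tendsto _).comp hquad))
  have hF0 : F 0 = 1 :=
    tendsto_nhds_unique (tendsto_const_nhds.congr fun t => (hconst t).symm) hlim
  rw [Complex.exp_neg]
  exact eq_inv_of_mul_eq_one_left (by simpa only [F, hx0] using hF0)

theorem IsPositiveStable.isStationarySolution_iff {A S : Matrix ι ι ℝ} (hA : IsPositiveStable A)
    (hS : A * S + S * Aᵀ = B * Bᵀ) :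
    IsStationarySolution (Matrix.toEuclideanCLM (𝕜 := ℝ) A) B π ↔ π = multivariateGaussian 0 S := by
  have hpsd : S.PosSemidef :=
    hA.posSemidef_of_lyapunov (Matrix.posSemidef_self_mul_conjTranspose B) hS
  refine ⟨fun hπ => ?_, ?_⟩
  · have := hπ.isProbabilityMeasure
    refine Measure.ext_of_charFun (funext fun ξ => ?_)
    rw [hπ.charFun_eq hA hS, charFun_multivariateGaussian hpsd]
    simp
  · rintro rfl
    exact isStationarySolution_multivariateGaussian hpsd hS

theorem IsPositiveStable.existsUnique_isStationarySolution {A : Matrix ι ι ℝ}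
    (hA : IsPositiveStable A) (B : Matrix ι κ ℝ) :
    ∃! π, IsStationarySolution (Matrix.toEuclideanCLM (𝕜 := ℝ) A) B π := by
  obtain ⟨S, hS⟩ := hA.exists_lyapunov (B * Bᵀ)
  simp only [hA.isStationarySolution_iff hS, existsUnique_eq]

end CharFun

section PrimalDual

variable {κ : Type*} [Fintype κ] {lam cf cg : ℝ}

theorem pdDrift_eq_toEuclideanCLM (lam cf cg k : ℝ) :
    pdDrift lam cf cg k = Matrix.toEuclideanCLM (𝕜 := ℝ) (pdMatrix lam cf cg k) :=
  rfl

theorem isPositiveStable_pdMatrix (hlam : 0 < lam) (hcf : 0 < cf) (hcg : 0 < cg) (k : ℝ) :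
    IsPositiveStable (pdMatrix lam cf cg k) := by
  refine ⟨.diagonal ![lam, 1], ?_, ?_⟩
  · rw [Matrix.posDef_diagonal_iff]
    simp [Fin.forall_fin_two, hlam]
  · have hdiagonal : .diagonal ![lam, 1] * pdMatrix lam cf cg k +
        (pdMatrix lam cf cg k)ᵀ * .diagonal ![lam, 1] =
        .diagonal ![2 * lam * cg⁻¹, 2 * lam * cf] := by
      ext i j
      fin_cases i <;> fin_cases j <;> simp [pdMatrix, Matrix.mul_apply] <;> ring
    rw [hdiagonal, Matrix.posDef_diagonal_iff]
    simp [Fin.forall_fin_two, hlam, hcf, hcg]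

theorem gaussTarget_eq_gaussianReal (hcf : 0 < cf) (hcg : 0 < cg) (k : ℝ) :
    gaussTarget cf cg k = gaussianReal 0 (k ^ 2 / cf + cg⁻¹)⁻¹.toNNReal := by
  set w := k ^ 2 / cf + cg⁻¹ with hw
  have hw0 : 0 < w := by positivity
  have hH x : -gaussH cf cg k x = -(w / 2) * x ^ 2 := by
    simp only [gaussH, gaussF, gaussG, hw]
    field_simp
  rw [gaussTarget, Measure.tilted, gaussianReal_of_var_ne_zero _ (by simpa using hw0)]
  congr 1
  ext x
  simp only [hH, integral_gaussian, gaussianPDF, gaussianPDFReal,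
    Real.coe_toNNReal _ (inv_pos.2 hw0).le, sub_zero]
  rw [div_eq_inv_mul]
  congr 3 <;> field_simp

theorem xMarginal_multivariateGaussian {S : Matrix (Fin 2) (Fin 2) ℝ} (hS : S.PosSemidef) :
    xMarginal (multivariateGaussian 0 S) = gaussianReal 0 (S 0 0).toNNReal :=
  (measurePreserving_eval_multivariateGaussian hS).map_eq

theorem xMarginal_multivariateGaussian_eq_gaussTarget_iff {k : ℝ} (hcf : 0 < cf) (hcg : 0 < cg)
    {S : Matrix (Fin 2) (Fin 2) ℝ} (hS : S.PosSemidef) :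
    xMarginal (multivariateGaussian 0 S) = gaussTarget cf cg k ↔
      S 0 0 = (k ^ 2 / cf + cg⁻¹)⁻¹ := by
  rw [xMarginal_multivariateGaussian hS, gaussTarget_eq_gaussianReal hcf hcg,
    gaussianReal_ext_iff]
  simp [Real.toNNReal_eq_toNNReal_iff hS.diag_nonneg (show 0 ≤ (k ^ 2 / cf + cg⁻¹)⁻¹ by positivity)]

theorem noise_relation_of_lyapunov_pdMatrix {k : ℝ} (hcf : 0 < cf) (hcg : 0 < cg)
    {S D : Matrix (Fin 2) (Fin 2) ℝ} (hsymm : S 1 0 = S 0 1)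
    (hS : pdMatrix lam cf cg k * S + S * (pdMatrix lam cf cg k)ᵀ = D)
    (h00 : S 0 0 = (k ^ 2 / cf + cg⁻¹)⁻¹) :
    (cg⁻¹ + lam * cf) * (lam * cf) =
      D 0 0 / 2 * ((cg⁻¹ + lam * cf) * (lam * cf) + lam * k ^ 2) -
        k * D 0 1 * (lam * cf) + k ^ 2 * D 1 1 / 2 := by
  have hvariance : S 0 0 * (lam * k ^ 2 + cg⁻¹ * (lam * cf)) = lam * cf := by
    rw [h00, inv_mul_eq_iff_eq_mul₀ (by positivity)]
    field_simp
  have hD00 := congrFun₂ hS 0 0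
  have hD01 := congrFun₂ hS 0 1
  have hD11 := congrFun₂ hS 1 1
  simp only [pdMatrix, Matrix.add_apply, Matrix.mul_apply, Matrix.transpose_apply,
    Fin.sum_univ_two, Matrix.of_apply, Matrix.cons_val', Matrix.cons_val_zero, Matrix.cons_val_one,
    Matrix.cons_val_fin_one, hsymm] at hD00 hD01 hD11
  linear_combination (-(cg⁻¹ + lam * cf)) * hvariance +
    (1 / 2 * ((cg⁻¹ + lam * cf) * (lam * cf) + lam * k ^ 2)) * hD00 - k * (lam * cf) * hD01 +
    k ^ 2 / 2 * hD11

theorem IsStationarySolution.noise_relation {k : ℝ} (hlam : 0 < lam) (hcf : 0 < cf) (hcg : 0 < cg)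
    {B : Matrix (Fin 2) κ ℝ} {π : Measure (EuclideanSpace ℝ (Fin 2))}
    (hπ : IsStationarySolution (pdDrift lam cf cg k) B π)
    (hx : xMarginal π = gaussTarget cf cg k) :
    (cg⁻¹ + lam * cf) * (lam * cf) =
      (B * Bᵀ) 0 0 / 2 * ((cg⁻¹ + lam * cf) * (lam * cf) + lam * k ^ 2) -
        k * (B * Bᵀ) 0 1 * (lam * cf) + k ^ 2 * (B * Bᵀ) 1 1 / 2 := by
  have hA := isPositiveStable_pdMatrix hlam hcf hcg k
  obtain ⟨S, hS⟩ := hA.exists_lyapunov (B * Bᵀ)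
  have hpsd := hA.posSemidef_of_lyapunov (Matrix.posSemidef_self_mul_conjTranspose B) hS
  rw [pdDrift_eq_toEuclideanCLM, hA.isStationarySolution_iff hS] at hπ
  rw [hπ, xMarginal_multivariateGaussian_eq_gaussTarget_iff hcf hcg hpsd] at hx
  exact noise_relation_of_lyapunov_pdMatrix hcf hcg (hpsd.isHermitian.apply 0 1) hS hx

theorem not_exists_noise_xMarginal_eq_gaussTarget (hlam : 0 < lam) :
    ¬ ∃ B : Matrix (Fin 2) κ ℝ, ∀ cf cg k : ℝ, 0 < cf → 0 < cg → k ≠ 0 →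
      ∃ π : Measure (EuclideanSpace ℝ (Fin 2)),
        IsStationarySolution (pdDrift lam cf cg k) B π ∧
          xMarginal π = gaussTarget cf cg k := by
  rintro ⟨B, hB⟩
  have hrelation {cg k : ℝ} (hcg : 0 < cg) (hk : k ≠ 0) :
      cg⁻¹ + 1 = (B * Bᵀ) 0 0 / 2 * (cg⁻¹ + 1 + lam * k ^ 2) - k * (B * Bᵀ) 0 1 +
        k ^ 2 * (B * Bᵀ) 1 1 / 2 := by
    obtain ⟨π, hπ, hx⟩ := hB lam⁻¹ cg k (inv_pos.2 hlam) hcg hk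
    simpa [mul_inv_cancel₀ hlam.ne'] using hπ.noise_relation hlam (inv_pos.2 hlam) hcg hx
  -- Varying `cg` forces `(B Bᵀ) 0 0 = 2`; adding the relations at `k = ±1` then leaves
  -- `2 * lam + (B Bᵀ) 1 1 = 0`.
  have hone := hrelation (cg := 1) (k := 1) one_pos one_ne_zero
  have hhalf := hrelation (cg := 2⁻¹) (k := 1) (by norm_num) one_ne_zero
  have hneg := hrelation (cg := 1) (k := -1) one_pos (by norm_num)
  have hB11 : 0 ≤ (B * Bᵀ) 1 1 := (Matrix.posSemidef_self_mul_conjTranspose B).diag_nonneg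
  simp only [inv_one, inv_inv, one_pow, even_two, Even.neg_pow, mul_one] at hone hhalf hneg
  have hB00 : (B * Bᵀ) 0 0 = 2 := by linarith
  rw [hB00] at hone hneg
  linarith

end PrimalDual

theorem mainTheorem8_general {κ : Type*} [Fintype κ] (lam : ℝ) (hlam : 0 < lam) :
    (∀ (B : Matrix (Fin 2) κ ℝ) (cf cg k : ℝ), 0 < cf → 0 < cg →
      ∃! π : Measure (EuclideanSpace ℝ (Fin 2)),
        IsStationarySolution (pdDrift lam cf cg k) B π) ∧
    ¬ ∃ B : Matrix (Fin 2) κ ℝ, ∀ cf cg k : ℝ, 0 < cf → 0 < cg → k ≠ 0 →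
      ∃ π : Measure (EuclideanSpace ℝ (Fin 2)),
        IsStationarySolution (pdDrift lam cf cg k) B π ∧
          xMarginal π = gaussTarget cf cg k :=
  ⟨fun B _ _ k hcf hcg =>
      (isPositiveStable_pdMatrix hlam hcf hcg k).existsUnique_isStationarySolution B,
    not_exists_noise_xMarginal_eq_gaussTarget hlam⟩

theorem mainTheorem8 (lam : ℝ) (hlam : 0 < lam) :
    (∀ (B : Matrix (Fin 2) (Fin 2) ℝ) (cf cg k : ℝ), 0 < cf → 0 < cg → k ≠ 0 →
      ∃! π : Measure (EuclideanSpace ℝ (Fin 2)),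
        IsStationarySolution (pdDrift lam cf cg k) B π) ∧
    ¬ ∃ B : Matrix (Fin 2) (Fin 2) ℝ, ∀ cf cg k : ℝ, 0 < cf → 0 < cg → k ≠ 0 →
      ∃ π : Measure (EuclideanSpace ℝ (Fin 2)),
        IsStationarySolution (pdDrift lam cf cg k) B π ∧
          xMarginal π = gaussTarget cf cg k :=
  ⟨fun B cf cg k hcf hcg _ => (mainTheorem8_general lam hlam).1 B cf cg k hcf hcg,
    (mainTheorem8_general lam hlam).2⟩
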